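/- Let $U\subset\mathbb{R}^2$ be a connected open set (with coordinates $u^1,u^2$) on which $u^1\neq 0$. Consider first-order homogeneous operators $$P_1=g^{ij}(u)\,\partial_x+\Gamma^{ij}_k(u)\,u^k_x\qquad (i,j=1,2)$$ with coefficients smooth on $U$, and the third-order homogeneous Hamiltonian operator $$R_3^{(3)}=\partial_x\begin{pmatrix}\partial_x & \partial_x\frac{u^2}{u^1}\\[2pt] \frac{u^2}{u^1}\partial_x & \frac{(u^2)^2+1}{2(u^1)^2}\partial_x+\partial_x\frac{(u^2)^2+1}{2(u^1)^2}\end{pmatrix}\partial_x ,$$ where $\partial_x f$ inside the matrix denotes the composition of $\partial_x$ with multiplication by $f$. An operator $P$ is called Hamiltonian if it is formally skew-adjoint and the bracket $\{F,G\}=\int \frac{\delta F}{\delta u^i}P^{ij}\frac{\delta G}{\delta u^j}\,dx$ satisfies the Jacobi identity; a Hamiltonian operator $P_1$ is compatible with $R_3^{(3)}$ if their Schouten bracket $[P_1,R_3^{(3)}]$ vanishes. Given smooth functions $g^{ij}$ on $U$, there are smooth $\Gamma^{ij}_k$ on $U$ such that $P_1$ is a Hamiltonian operator compatible with $R_3^{(3)}$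 if and only if there are real constants $c_1,\dots,c_6$ with $$\begin{aligned} g^{11}&=c_1u^1+c_2u^2+c_3,\\ g^{12}=g^{21}&=c_4u^1-\frac{c_2}{2u^1}+\frac{c_3u^2}{u^1}+\frac{c_2(u^2)^2}{2u^1},\\ g^{22}&=2c_4u^2+\frac{c_1}{u^1}+\frac{c_5u^2}{u^1}-\frac{c_1(u^2)^2}{u^1}+c_6, \end{aligned}$$ and $$c_2c_5+2c_1c_3=0,\qquad c_2c_6-2c_3c_4=0,\qquad c_1c_6+c_4c_5=0 .$$ Moreover, if $\det(g^{ij})\neq0$ everywhere on $U$, then $P_1$, with given smooth $\Gamma^{ij}_k$, is a Hamiltonian operator compatible with $R_3^{(3)}$ if and only if the $\Gamma^{ij}_k$ are the contravariant Christoffel symbols of the Levi-Civita connection of $g$, that is, $g^{is}\Gamma^{jk}_s=g^{js}\Gamma^{ik}_s$ and $\Gamma^{ij}_k+\Gamma^{ji}_k=\partial_kg^{ij}$, and $g^{ij}$ has the above form with constants satisfying the above quadratic conditions. -/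

import Mathlib

open scoped ContDiff

noncomputable section

/-- Two-component functions of one real variable `x`. They serve both as fields `u = (u¹, u²)` and
as covectors `ψ = (ψ₁, ψ₂)`; the components are numbered `0` and `1`. -/
abbrev TwoFun := ℝ → Fin 2 → ℝ

/-- Matrix operators acting on two-component functions of `x`, with coefficients depending on the
field: `P u ψ` is the value on `ψ` of the operator `P` taken at the field `u`. -/
abbrev FieldOperator := TwoFun → TwoFun → TwoFun

/-- Smooth fields with values in the coordinate domain `U`. -/
def IsSmoothField (U : Set (Fin 2 → ℝ)) (u : TwoFun) : Prop :=
  ContDiff ℝ ∞ u ∧ ∀ x, u x ∈ U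

/-- Test covectors: smooth with compact support. -/
def IsTest (ψ : TwoFun) : Prop :=
  ContDiff ℝ ∞ ψ ∧ HasCompactSupport ψ

/-- The pairing `∫ a_i b^i dx`. -/
def pairing (a b : TwoFun) : ℝ := ∫ x, ∑ i, a x i * b x i

/-- The operator `D_u P [v]`: the directional (Gateaux) derivative of the coefficients of `P` at the
field `u` in the direction `v`, applied to `ψ`. -/
def coeffDeriv (P : FieldOperator) (u v ψ : TwoFun) : TwoFun :=
  fun x i => deriv (fun t : ℝ => P (u + t • v) ψ x i) 0

/-- For the linear functionals `F_a(u) = ∫ a_i u^i dx`, whose variational derivative is `a`, and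
the bracket `{F, G}_P = ∫ (δF) P (δG) dx`, this is `{{F_a, F_b}_P, F_c}_Q` at the field `u`. -/
def iteratedBracket (P Q : FieldOperator) (u a b c : TwoFun) : ℝ :=
  pairing a (coeffDeriv P u (Q u c) b)

/-- Formal skew-adjointness `P* = -P`. -/
def IsSkewAdjoint (U : Set (Fin 2 → ℝ)) (P : FieldOperator) : Prop :=
  ∀ u, IsSmoothField U u → ∀ a b, IsTest a → IsTest b → pairing a (P u b) = -pairing (P u a) b

/-- The cyclic sum of iterated brackets; its vanishing for `Q = P` is the Jacobi identity. -/
def jacobiator (P Q : FieldOperator) (u a b c : TwoFun) : ℝ :=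
  iteratedBracket P Q u a b c + iteratedBracket P Q u b c a + iteratedBracket P Q u c a b

/-- `P` is a Hamiltonian operator: it is skew-adjoint and its bracket satisfies the Jacobi
identity. -/
def IsHamiltonian (U : Set (Fin 2 → ℝ)) (P : FieldOperator) : Prop :=
  IsSkewAdjoint U P ∧
    ∀ u, IsSmoothField U u → ∀ a b c, IsTest a → IsTest b → IsTest c → jacobiator P P u a b c = 0

/-- The Schouten bracket `[P, Q]`, the three-vector that polarizes the jacobiator, vanishes. For
Hamiltonian operators `P` and `Q` this is compatibility. -/
def SchoutenBracketVanishes (U : Set (Fin 2 → ℝ)) (P Q : FieldOperator) : Prop :=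
  ∀ u, IsSmoothField U u → ∀ a b c, IsTest a → IsTest b → IsTest c →
    jacobiator P Q u a b c + jacobiator Q P u a b c = 0

/-- The first-order homogeneous operator `g^{ij}(u) ∂ₓ + Γ^{ij}_k(u) u^k_x`. -/
def hydroOperator (g : Fin 2 → Fin 2 → (Fin 2 → ℝ) → ℝ)
    (Γ : Fin 2 → Fin 2 → Fin 2 → (Fin 2 → ℝ) → ℝ) : FieldOperator :=
  fun u ψ x i => ∑ j, (g i j (u x) * deriv (fun y => ψ y j) x
    + (∑ k, Γ i j k (u x) * deriv (fun y => u y k) x) * ψ x j)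

/-- The third-order operator
`∂ₓ ∘ [[∂ₓ, ∂ₓ ∘ q], [q ∂ₓ, s ∂ₓ + ∂ₓ ∘ s]] ∘ ∂ₓ` with `q = u²/u¹` and
`s = ((u²)² + 1) / (2 (u¹)²)`. -/
def thirdOrderOperator : FieldOperator :=
  fun u ψ =>
    let q : ℝ → ℝ := fun y => u y 1 / u y 0
    let s : ℝ → ℝ := fun y => ((u y 1) ^ 2 + 1) / (2 * (u y 0) ^ 2)
    let w₁ : ℝ → ℝ := deriv (fun y => ψ y 0)
    let w₂ : ℝ → ℝ := deriv (fun y => ψ y 1)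
    fun x =>
      ![deriv (fun y => deriv w₁ y + deriv (fun z => q z * w₂ z) y) x,
        deriv (fun y => q y * deriv w₁ y
          + (s y * deriv w₂ y + deriv (fun z => s z * w₂ z) y)) x]

/-- The partial derivative `∂f/∂u^k`. -/
def partialDeriv (k : Fin 2) (f : (Fin 2 → ℝ) → ℝ) (p : Fin 2 → ℝ) : ℝ :=
  fderiv ℝ f p (Pi.single k 1)

/-- `Γ^{ij}_k` are the contravariant Christoffel symbols (`Γ^{ij}_k = -g^{il} Γ^j_{lk}`) of the
Levi-Civita connection of the contravariant metric `g^{ij}`: the connection is torsion-free and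
preserves the metric. -/
def IsLeviCivita (U : Set (Fin 2 → ℝ)) (g : Fin 2 → Fin 2 → (Fin 2 → ℝ) → ℝ)
    (Γ : Fin 2 → Fin 2 → Fin 2 → (Fin 2 → ℝ) → ℝ) : Prop :=
  ∀ p ∈ U,
    (∀ i j k, ∑ s, g i s p * Γ j k s p = ∑ s, g j s p * Γ i k s p) ∧
    (∀ i j k, Γ i j k p + Γ j i k p = partialDeriv k (g i j) p)

/-- The rational form of the metric with constants `c₁, …, c₆` on `U`. -/
def HasRationalForm (U : Set (Fin 2 → ℝ)) (g : Fin 2 → Fin 2 → (Fin 2 → ℝ) → ℝ)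
    (c₁ c₂ c₃ c₄ c₅ c₆ : ℝ) : Prop :=
  ∀ p ∈ U,
    g 0 0 p = c₁ * p 0 + c₂ * p 1 + c₃ ∧
    g 0 1 p = c₄ * p 0 - c₂ / (2 * p 0) + c₃ * p 1 / p 0 + c₂ * (p 1) ^ 2 / (2 * p 0) ∧
    g 1 0 p = g 0 1 p ∧
    g 1 1 p = 2 * c₄ * p 1 + c₁ / p 0 + c₅ * p 1 / p 0 - c₁ * (p 1) ^ 2 / p 0 + c₆

/-- The quadratic conditions on the constants. -/
def QuadraticConditions (c₁ c₂ c₃ c₄ c₅ c₆ : ℝ) : Prop :=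
  c₂ * c₅ + 2 * c₁ * c₃ = 0 ∧ c₂ * c₆ - 2 * c₃ * c₄ = 0 ∧ c₁ * c₆ + c₄ * c₅ = 0

end

/-!
The theorem is proved by turning the integral identities that define Hamiltonian and compatible
operators into pointwise identities in the jets of the field and of three covectors, and solving the
overdetermined system that results.

*Densities.* After integration by parts the Jacobiator of `P₁` and the Schouten bracket
`[P₁, R₃]` are the integrals of explicit densities (`jacobiator_hydroOperator`,
`jacobiator_add_jacobiator`), in which the variation of each operator enters through a covector:
`hydroDensity` and `thirdDensity`. Since the densities are local, two of the three covectors may be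
arbitrary smooth functions, for instance polynomials, as long as the third has compact support
(`IsLocalDensity.integral_eq_zero`).

*Necessity.* Skew-adjointness gives `g^{ij} = g^{ji}` and `∂_k g^{ij} = Γ^{ij}_k + Γ^{ji}_k`. At a
constant field `R₃` has constant coefficients, and polynomial covectors turn the brackets into
moments of a test function. The Jacobi identity yields `g^{is} Γ^{jk}_s = g^{js} Γ^{ik}_s`
(`torsion_of_isHamiltonian`), and compatibility yields that `Γ` contracted with the leading
coefficient of `R₃` is symmetric (`leading_symm`) together with
`Γ^{12}_1 - Γ^{21}_1 = g^{12}/u¹` and `Γ^{12}_2 - Γ^{21}_2 = -g^{11}/u¹` (`antisymm_relation_q`,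
`antisymm_relation_s`). Fields that move along a line and covectors of degree at most one in `x`
give in addition that `Γ^{12}_k` is closed (`partialDeriv_offDiag_comm`) and relations for the
Hessians of `g^{11}` and `g^{22}` (`hessian_relation_first`, `hessian_relation_second`). These
linear equations determine all of `Γ` from `g` and integrate on the connected set `U`: `g^{11}` is
affine, then `g^{12}` and `g^{22}` follow (`solve_first_row`, `solve_second_row`). For the metrics
so obtained the torsion relation is equivalent to the quadratic conditions on the constants
(`exists_rationalForm`). Nondegeneracy of `g` is never used.

*Sufficiency.* For a rational metric the symbols are the explicit functions `rationalGamma`. They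
satisfy `∂_l Γ^{ij}_k = ∂_k Γ^{ij}_l`, so that the variation of `P₁` reduces to `hydroCovector`. By
the quadratic conditions the torsion relation and `Γ^{j1}_l Γ^{l2}_m = Γ^{j2}_l Γ^{l1}_m` hold, and
with them the density of the Jacobiator vanishes identically (`jacobiDensity_eq_zero`). As
`R₃ = ∂ₓ ∘ W`, the density of the Schouten bracket is the `x`-derivative of the cyclic sum of
`hydroCovector` contracted with the flux `W` (`hasDerivAt_schoutenPrimitive`), so its integral
vanishes.

*Nondegenerate metrics.* If `det g ≠ 0`, the Levi-Civita conditions are a linear system with at most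
one solution, and `rationalGamma` is a solution (`IsLeviCivita.eq_rationalGamma`).
-/

open scoped ContDiff
open MeasureTheory Filter Topology

/-! ### Calculus for two-component functions on the line -/

/-- The componentwise `x`-derivative of a two-component function. -/
noncomputable def xDeriv (a : TwoFun) : TwoFun := fun x i => deriv (fun y => a y i) x

theorem contDiff_component {a : TwoFun} (ha : ContDiff ℝ ∞ a) (i : Fin 2) :
    ContDiff ℝ ∞ (fun y => a y i) :=
  contDiff_pi.1 ha i

theorem contDiff_deriv {f : ℝ → ℝ} (hf : ContDiff ℝ ∞ f) : ContDiff ℝ ∞ (deriv f) :=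
  (contDiff_infty_iff_deriv.1 hf).2

theorem contDiff_hasDerivAt {f : ℝ → ℝ} (hf : ContDiff ℝ ∞ f) (x : ℝ) :
    HasDerivAt f (deriv f x) x :=
  ((contDiff_infty_iff_deriv.1 hf).1 x).hasDerivAt

theorem contDiff_xDeriv {a : TwoFun} (ha : ContDiff ℝ ∞ a) : ContDiff ℝ ∞ (xDeriv a) :=
  contDiff_pi.2 fun i => contDiff_deriv (contDiff_component ha i)

theorem hasDerivAt_component {a : TwoFun} (ha : ContDiff ℝ ∞ a) (i : Fin 2) (x : ℝ) :
    HasDerivAt (fun y => a y i) (xDeriv a x i) x :=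
  contDiff_hasDerivAt (contDiff_component ha i) x

theorem xDeriv_congr {a b : TwoFun} {x : ℝ} (h : a =ᶠ[𝓝 x] b) : xDeriv a =ᶠ[𝓝 x] xDeriv b := by
  filter_upwards [h.eventuallyEq_nhds] with y hy
  funext i
  exact Filter.EventuallyEq.deriv_eq (hy.mono fun z hz => by simp only [hz])

theorem xDeriv_zero : xDeriv 0 = 0 := by
  funext x i
  simp [xDeriv]

theorem xDeriv_eq_zero_of_eventuallyEq {a : TwoFun} {x : ℝ} (h : a =ᶠ[𝓝 x] 0) :
    xDeriv a =ᶠ[𝓝 x] 0 := by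
  simpa only [xDeriv_zero] using xDeriv_congr h

theorem tsupport_xDeriv_subset (a : TwoFun) : tsupport (xDeriv a) ⊆ tsupport a := by
  intro x hx
  by_contra h
  exact (notMem_tsupport_iff_eventuallyEq.2
    (xDeriv_eq_zero_of_eventuallyEq (notMem_tsupport_iff_eventuallyEq.1 h))) hx

theorem eq_zero_of_notMem_tsupport {a : TwoFun} {x : ℝ} (h : x ∉ tsupport a) : a x = 0 :=
  image_eq_zero_of_notMem_tsupport h

theorem xDeriv_eq_zero_of_notMem {a : TwoFun} {x : ℝ} (h : x ∉ tsupport a) : xDeriv a x = 0 :=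
  eq_zero_of_notMem_tsupport fun h' => h (tsupport_xDeriv_subset a h')

theorem xDeriv_notMem_tsupport {a : TwoFun} {x : ℝ} (h : x ∉ tsupport a) :
    x ∉ tsupport (xDeriv a) :=
  fun h' => h (tsupport_xDeriv_subset a h')

/-! ### Integration by parts -/

/-- A continuous function that vanishes off a compact set is integrable. -/
theorem integrable_of_eq_zero_off {f : ℝ → ℝ} (hf : Continuous f) {K : Set ℝ} (hK : IsCompact K)
    (h : ∀ x, x ∉ K → f x = 0) : Integrable f :=
  hf.integrable_of_hasCompactSupport (HasCompactSupport.intro hK h)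

/-- Two densities that differ by the derivative of a compactly supported function have the same
integral. -/
theorem integral_eq_of_hasDerivAt_sub {F f g : ℝ → ℝ} (hF : ∀ x, HasDerivAt F (f x - g x) x)
    (hf : Continuous f) (hg : Continuous g) {K : Set ℝ} (hK : IsCompact K)
    (hFK : ∀ x, x ∉ K → F x = 0) (hfK : ∀ x, x ∉ K → f x = 0) (hgK : ∀ x, x ∉ K → g x = 0) :
    ∫ x, f x = ∫ x, g x := by
  have hFc : Continuous F := continuous_iff_continuousAt.2 fun x => (hF x).continuousAt
  have hfi := integrable_of_eq_zero_off hf hK hfK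
  have hgi := integrable_of_eq_zero_off hg hK hgK
  have := integral_eq_zero_of_hasDerivAt_of_integrable hF (hfi.sub hgi)
    (integrable_of_eq_zero_off hFc hK hFK)
  rw [integral_sub hfi hgi] at this
  linarith

theorem integral_mul_deriv_test {f ψ : ℝ → ℝ} (hf : ContDiff ℝ ∞ f) (hψ : ContDiff ℝ ∞ ψ)
    (hc : HasCompactSupport ψ) : ∫ x, f x * deriv ψ x = ∫ x, -(deriv f x * ψ x) := by
  have h1 := hf.continuous
  have h2 := hψ.continuous
  have h3 := (contDiff_deriv hf).continuous
  have h4 := (contDiff_deriv hψ).continuous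
  refine integral_eq_of_hasDerivAt_sub (F := fun x => f x * ψ x) (fun x => ?_) (by fun_prop)
    (by fun_prop) hc ?_ ?_ ?_
  · exact ((contDiff_hasDerivAt hf x).mul (contDiff_hasDerivAt hψ x)).congr_deriv (by ring)
  · intro x hx
    simp [image_eq_zero_of_notMem_tsupport hx]
  · intro x hx
    have : deriv ψ x = 0 := image_eq_zero_of_notMem_tsupport fun h =>
      hx (tsupport_deriv_subset h)
    simp [this]
  · intro x hx
    simp [image_eq_zero_of_notMem_tsupport hx]

/-- The fundamental lemma of the calculus of variations, for continuous functions on the line. -/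
theorem eq_zero_of_forall_integral_mul_test {h : ℝ → ℝ} (hh : Continuous h)
    (H : ∀ ψ : ℝ → ℝ, ContDiff ℝ ∞ ψ → HasCompactSupport ψ → ∫ x, h x * ψ x = 0) (x : ℝ) :
    h x = 0 := by
  have := ae_eq_zero_of_integral_contDiff_smul_eq_zero (μ := volume)
    (hh.locallyIntegrable) (fun ψ hψ hc => by
      simpa [smul_eq_mul, mul_comm] using H ψ hψ hc)
  have h2 : h = fun _ => (0 : ℝ) :=
    (Continuous.ae_eq_iff_eq (μ := volume) hh continuous_const).1 this
  exact congrFun h2 x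

theorem eq_zero_of_deriv_eq_zero_of_hasCompactSupport {f : ℝ → ℝ} (hf : ContDiff ℝ ∞ f)
    (hc : HasCompactSupport f) (h : ∀ x, deriv f x = 0) (x : ℝ) : f x = 0 := by
  obtain ⟨y, hy⟩ : ∃ y, y ∉ tsupport f := by
    by_contra! hall
    have : tsupport f = Set.univ := Set.eq_univ_of_forall hall
    exact noncompact_univ ℝ (this ▸ hc)
  rw [is_const_of_deriv_eq_zero (contDiff_infty_iff_deriv.1 hf).1 h x y]
  exact image_eq_zero_of_notMem_tsupport hy

theorem eq_zero_of_forall_integral_mul_deriv {f : ℝ → ℝ} (hf : ContDiff ℝ ∞ f)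
    (hc : HasCompactSupport f)
    (H : ∀ ψ : ℝ → ℝ, ContDiff ℝ ∞ ψ → HasCompactSupport ψ → ∫ x, f x * deriv ψ x = 0) (x : ℝ) :
    f x = 0 := by
  refine eq_zero_of_deriv_eq_zero_of_hasCompactSupport hf hc (fun y => ?_) x
  refine eq_zero_of_forall_integral_mul_test (contDiff_deriv hf).continuous (fun ψ hψ hψc => ?_) y
  have := H ψ hψ hψc
  rw [integral_mul_deriv_test hf hψ hψc, integral_neg] at this
  linarith

theorem eq_zero_of_forall_integral_mul_deriv_deriv {f : ℝ → ℝ} (hf : ContDiff ℝ ∞ f)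
    (hc : HasCompactSupport f)
    (H : ∀ ψ : ℝ → ℝ, ContDiff ℝ ∞ ψ → HasCompactSupport ψ →
      ∫ x, f x * deriv (deriv ψ) x = 0) (x : ℝ) :
    f x = 0 := by
  refine eq_zero_of_deriv_eq_zero_of_hasCompactSupport hf hc (fun y => ?_) x
  refine eq_zero_of_forall_integral_mul_deriv (contDiff_deriv hf) hc.deriv
    (fun ψ hψ hψc => ?_) y
  have := H ψ hψ hψc
  rw [integral_mul_deriv_test hf (contDiff_deriv hψ) hψc.deriv, integral_neg] at this
  linarith

/-- If `A ψ''' + B ψ''` has vanishing integral for all test functions `ψ`, then the second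
derivative of `B - A'` vanishes; compact support of `B - A'` then forces `B = A'`. -/
theorem eq_deriv_of_forall_integral {A B : ℝ → ℝ} (hA : ContDiff ℝ ∞ A) (hB : ContDiff ℝ ∞ B)
    (hc : HasCompactSupport fun x => B x - deriv A x)
    (H : ∀ ψ : ℝ → ℝ, ContDiff ℝ ∞ ψ → HasCompactSupport ψ →
      ∫ x, (A x * deriv (deriv (deriv ψ)) x + B x * deriv (deriv ψ) x) = 0) (x : ℝ) :
    B x = deriv A x := by
  have h := eq_zero_of_forall_integral_mul_deriv_deriv (f := fun x => B x - deriv A x)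
    (hB.sub (contDiff_deriv hA)) hc (fun ψ hψ hψc => ?_) x
  · exact sub_eq_zero.1 h
  have h0 := H ψ hψ hψc
  have hψ2 := contDiff_deriv (contDiff_deriv hψ)
  have hψc2 := hψc.deriv.deriv
  have c1 := hA.continuous
  have c2 := hB.continuous
  have c3 := hψ2.continuous
  have c4 := (contDiff_deriv hψ2).continuous
  have c5 := (contDiff_deriv hA).continuous
  have i1 : Integrable fun x => A x * deriv (deriv (deriv ψ)) x :=
    (c1.mul c4).integrable_of_hasCompactSupport hψc2.deriv.mul_left
  have i2 : Integrable fun x => B x * deriv (deriv ψ) x :=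
    (c2.mul c3).integrable_of_hasCompactSupport hψc2.mul_left
  have i3 : Integrable fun x => deriv A x * deriv (deriv ψ) x :=
    (c5.mul c3).integrable_of_hasCompactSupport hψc2.mul_left
  rw [integral_add i1 i2, integral_mul_deriv_test hA hψ2 hψc2, integral_neg] at h0
  simp only [sub_mul]
  rw [integral_sub i2 i3]
  linarith

/-! ### Differentiating an operator along a variation of the field -/

/-- Differentiation in the parameter commutes with differentiation in the space variable. The
first half allows the statement to be iterated. -/
theorem deriv_deriv_comm {F : ℝ → ℝ → ℝ}
    (hF : ∀ y, ContDiffAt ℝ ∞ (Function.uncurry F) (0, y)) :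
    (∀ y, ContDiffAt ℝ ∞ (Function.uncurry fun t => deriv (F t)) (0, y)) ∧
      ∀ y, deriv (fun t => deriv (F t) y) 0 = deriv (fun z => deriv (fun t => F t z) 0) y := by
  set G := Function.uncurry F with hG
  have key : ∀ p : ℝ × ℝ, DifferentiableAt ℝ G p →
      deriv (F p.1) p.2 = fderiv ℝ G p (0, 1) ∧
        deriv (fun t => F t p.2) p.1 = fderiv ℝ G p (1, 0) := by
    rintro ⟨t, y⟩ hp
    have h1 : HasDerivAt (fun z => ((t, z) : ℝ × ℝ)) (0, 1) y :=
      (hasDerivAt_const y t).prodMk (hasDerivAt_id y)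
    have h2 : HasDerivAt (fun z => ((z, y) : ℝ × ℝ)) (1, 0) t :=
      (hasDerivAt_id t).prodMk (hasDerivAt_const t y)
    have hh : HasFDerivAt G (fderiv ℝ G (t, y)) (t, y) := hp.hasFDerivAt
    have e1 : HasDerivAt (fun z => F t z) (fderiv ℝ G (t, y) (0, 1)) y :=
      HasFDerivAt.comp_hasDerivAt (f := fun z => ((t, z) : ℝ × ℝ)) y hh h1
    have e2 : HasDerivAt (fun z => F z y) (fderiv ℝ G (t, y) (1, 0)) t :=
      HasFDerivAt.comp_hasDerivAt (f := fun z => ((z, y) : ℝ × ℝ)) t hh h2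
    exact ⟨e1.deriv, e2.deriv⟩
  have hev : ∀ y, ∀ᶠ p in 𝓝 ((0 : ℝ), y), DifferentiableAt ℝ G p := fun y =>
    (((hF y).of_le (m := 1) (by simp)).eventually (by simp)).mono
      fun p hp => hp.differentiableAt (by simp)
  have hfd : ∀ y, ContDiffAt ℝ ∞ (fderiv ℝ G) (0, y) := fun y =>
    (hF y).fderiv_right (by simp)
  have e1 : ∀ y, (Function.uncurry fun t => deriv (F t)) =ᶠ[𝓝 ((0 : ℝ), y)]
      fun p => fderiv ℝ G p (0, 1) := fun y =>
    (hev y).mono fun p hp => (key p hp).1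
  refine ⟨fun y => ((hfd y).clm_apply contDiffAt_const).congr_of_eventuallyEq (e1 y), fun y => ?_⟩
  have hdd : HasFDerivAt (fderiv ℝ G) (fderiv ℝ (fderiv ℝ G) (0, y)) (0, y) :=
    ((hfd y).differentiableAt (by simp)).hasFDerivAt
  have h1 : HasDerivAt (fun z => (((0 : ℝ), z) : ℝ × ℝ)) (0, 1) y :=
    (hasDerivAt_const y (0 : ℝ)).prodMk (hasDerivAt_id y)
  have h2 : HasDerivAt (fun z => ((z, y) : ℝ × ℝ)) (1, 0) 0 :=
    (hasDerivAt_id (0 : ℝ)).prodMk (hasDerivAt_const (0 : ℝ) y)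
  have hw : ∀ w : ℝ × ℝ, HasFDerivAt (fun p => fderiv ℝ G p w)
      ((fderiv ℝ (fderiv ℝ G) (0, y)).flip w) (0, y) := fun w =>
    ((ContinuousLinearMap.apply ℝ ℝ w).hasFDerivAt.comp ((0 : ℝ), y) hdd).congr_fderiv
      (by ext <;> simp)
  have l1 : deriv (fun t => deriv (F t) y) 0 = fderiv ℝ (fderiv ℝ G) (0, y) (1, 0) (0, 1) := by
    have hh : HasDerivAt (fun t => fderiv ℝ G (t, y) (0, 1)) _ 0 :=
      HasFDerivAt.comp_hasDerivAt (f := fun z => ((z, y) : ℝ × ℝ)) 0 (hw (0, 1)) h2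
    refine (hh.congr_of_eventuallyEq ?_).deriv
    exact (h2.continuousAt.tendsto.eventually (hev y)).mono fun t ht => (key (t, y) ht).1
  have l2 : deriv (fun z => deriv (fun t => F t z) 0) y =
      fderiv ℝ (fderiv ℝ G) (0, y) (0, 1) (1, 0) := by
    have hh : HasDerivAt (fun z => fderiv ℝ G (0, z) (1, 0)) _ y :=
      HasFDerivAt.comp_hasDerivAt (f := fun z => (((0 : ℝ), z) : ℝ × ℝ)) y (hw (1, 0)) h1
    refine (hh.congr_of_eventuallyEq ?_).deriv
    exact (h1.continuousAt.tendsto.eventually (hev y)).mono fun z hz => (key (0, z) hz).2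
  rw [l1, l2]
  exact (hF y).isSymmSndFDerivAt (by simpa using WithTop.coe_le_coe.2 (le_top : (2 : ℕ∞) ≤ ⊤)) _ _

/-- The coefficient `q = u²/u¹` of the third-order operator along a field. -/
noncomputable def qField (u : TwoFun) : ℝ → ℝ := fun y => u y 1 / u y 0

/-- The coefficient `s = ((u²)² + 1) / (2 (u¹)²)` of the third-order operator along a field. -/
noncomputable def sField (u : TwoFun) : ℝ → ℝ := fun y => ((u y 1) ^ 2 + 1) / (2 * (u y 0) ^ 2)

/-- The variation of `qField` at `u` in the direction `v`. -/
noncomputable def qVar (u v : TwoFun) : ℝ → ℝ :=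
  fun y => -(u y 1 / (u y 0) ^ 2) * v y 0 + 1 / u y 0 * v y 1

/-- The variation of `sField` at `u` in the direction `v`. -/
noncomputable def sVar (u v : TwoFun) : ℝ → ℝ :=
  fun y => -(((u y 1) ^ 2 + 1) / (u y 0) ^ 3) * v y 0 + u y 1 / (u y 0) ^ 2 * v y 1

section
variable {u v : TwoFun}

theorem contDiff_qField (hu : ContDiff ℝ ∞ u) (h0 : ∀ x, u x 0 ≠ 0) :
    ContDiff ℝ ∞ (qField u) :=
  (contDiff_component hu 1).div (contDiff_component hu 0) h0

theorem contDiff_sField (hu : ContDiff ℝ ∞ u) (h0 : ∀ x, u x 0 ≠ 0) :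
    ContDiff ℝ ∞ (sField u) :=
  (((contDiff_component hu 1).pow 2).add contDiff_const).div
    (contDiff_const.mul ((contDiff_component hu 0).pow 2))
    fun x => mul_ne_zero two_ne_zero (pow_ne_zero 2 (h0 x))

theorem contDiff_qVar (hu : ContDiff ℝ ∞ u) (hv : ContDiff ℝ ∞ v) (h0 : ∀ x, u x 0 ≠ 0) :
    ContDiff ℝ ∞ (qVar u v) := by
  have a0 := contDiff_component hu 0
  have a1 := contDiff_component hu 1
  have b0 := contDiff_component hv 0
  have b1 := contDiff_component hv 1
  exact (((a1.div (a0.pow 2) fun x => pow_ne_zero 2 (h0 x)).neg).mul b0).add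
    ((contDiff_const.div a0 h0).mul b1)

theorem contDiff_sVar (hu : ContDiff ℝ ∞ u) (hv : ContDiff ℝ ∞ v) (h0 : ∀ x, u x 0 ≠ 0) :
    ContDiff ℝ ∞ (sVar u v) := by
  have a0 := contDiff_component hu 0
  have a1 := contDiff_component hu 1
  have b0 := contDiff_component hv 0
  have b1 := contDiff_component hv 1
  exact (((((a1.pow 2).add contDiff_const).div (a0.pow 3)
    fun x => pow_ne_zero 3 (h0 x)).neg).mul b0).add
    ((a1.div (a0.pow 2) fun x => pow_ne_zero 2 (h0 x)).mul b1)

theorem hasDerivAt_add_smul (i : Fin 2) (y : ℝ) :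
    HasDerivAt (fun t : ℝ => (u + t • v) y i) (v y i) 0 := by
  simpa using ((hasDerivAt_id (0 : ℝ)).mul_const (v y i)).const_add (u y i)

theorem hasDerivAt_qField_add_smul (h0 : ∀ x, u x 0 ≠ 0) (y : ℝ) :
    HasDerivAt (fun t : ℝ => qField (u + t • v) y) (qVar u v y) 0 := by
  have hy := h0 y
  have := (hasDerivAt_add_smul (u := u) (v := v) 1 y).div
    (hasDerivAt_add_smul (u := u) (v := v) 0 y) (by simpa using hy)
  refine this.congr_deriv ?_
  simp [qVar]
  field_simp
  ring

theorem hasDerivAt_sField_add_smul (h0 : ∀ x, u x 0 ≠ 0) (y : ℝ) :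
    HasDerivAt (fun t : ℝ => sField (u + t • v) y) (sVar u v y) 0 := by
  have hy := h0 y
  have := (((hasDerivAt_add_smul (u := u) (v := v) 1 y).pow 2).add_const 1).div
    (((hasDerivAt_add_smul (u := u) (v := v) 0 y).pow 2).const_mul 2)
    (by simpa using hy)
  refine this.congr_deriv ?_
  simp [sVar]
  field_simp
  ring

theorem contDiff_uncurry_component_add_smul (hu : ContDiff ℝ ∞ u) (hv : ContDiff ℝ ∞ v)
    (i : Fin 2) :
    ContDiff ℝ ∞ (fun p : ℝ × ℝ => (u + p.1 • v) p.2 i) := by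
  have h1 := contDiff_component hu i
  have h2 := contDiff_component hv i
  change ContDiff ℝ ∞ (fun p : ℝ × ℝ => u p.2 i + p.1 * v p.2 i)
  exact (h1.comp contDiff_snd).add (contDiff_fst.mul (h2.comp contDiff_snd))

theorem contDiffAt_uncurry_qField (hu : ContDiff ℝ ∞ u) (hv : ContDiff ℝ ∞ v)
    (h0 : ∀ x, u x 0 ≠ 0) (y : ℝ) :
    ContDiffAt ℝ ∞ (fun p : ℝ × ℝ => qField (u + p.1 • v) p.2) (0, y) :=
  (contDiff_uncurry_component_add_smul hu hv 1).contDiffAt.div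
    (contDiff_uncurry_component_add_smul hu hv 0).contDiffAt (by simpa using h0 y)

theorem contDiffAt_uncurry_sField (hu : ContDiff ℝ ∞ u) (hv : ContDiff ℝ ∞ v)
    (h0 : ∀ x, u x 0 ≠ 0) (y : ℝ) :
    ContDiffAt ℝ ∞ (fun p : ℝ × ℝ => sField (u + p.1 • v) p.2) (0, y) :=
  (((contDiff_uncurry_component_add_smul hu hv 1).contDiffAt.pow 2).add contDiffAt_const).div
    (contDiffAt_const.mul ((contDiff_uncurry_component_add_smul hu hv 0).contDiffAt.pow 2))
    (by simpa using h0 y)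

/-- The value on `c` of the matrix operator `[[∂ₓ, ∂ₓ ∘ q], [q ∂ₓ, s ∂ₓ + ∂ₓ ∘ s]] ∘ ∂ₓ` with
arbitrary coefficients `q` and `s`; the third-order operator is its `x`-derivative. -/
noncomputable def thirdFlux (q s : ℝ → ℝ) (c : TwoFun) : TwoFun := fun y =>
  ![xDeriv (xDeriv c) y 0 + deriv (fun z => q z * xDeriv c z 1) y,
    q y * xDeriv (xDeriv c) y 0 +
      (s y * xDeriv (xDeriv c) y 1 + deriv (fun z => s z * xDeriv c z 1) y)]

theorem thirdOrderOperator_eq_xDeriv (u c : TwoFun) :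
    thirdOrderOperator u c = xDeriv (thirdFlux (qField u) (sField u) c) := by
  funext x i
  fin_cases i <;> rfl

theorem contDiff_thirdFlux {q s : ℝ → ℝ} (hq : ContDiff ℝ ∞ q) (hs : ContDiff ℝ ∞ s) {c : TwoFun}
    (hc : ContDiff ℝ ∞ c) : ContDiff ℝ ∞ (thirdFlux q s c) := by
  have h1 := contDiff_xDeriv hc
  have h2 := contDiff_xDeriv h1
  have a := contDiff_component h1 1
  refine contDiff_pi.2 fun i => ?_
  fin_cases i
  · exact (contDiff_component h2 0).add (contDiff_deriv (hq.mul a))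
  · exact (hq.mul (contDiff_component h2 0)).add
      ((hs.mul (contDiff_component h2 1)).add (contDiff_deriv (hs.mul a)))

/-- The terms of `thirdFlux` that depend on the coefficients; it is their variation. -/
noncomputable def fluxVar (q s : ℝ → ℝ) (c : TwoFun) : TwoFun := fun y =>
  ![deriv (fun z => q z * xDeriv c z 1) y,
    q y * xDeriv (xDeriv c) y 0 +
      (s y * xDeriv (xDeriv c) y 1 + deriv (fun z => s z * xDeriv c z 1) y)]

theorem coeffDeriv_thirdOrderOperator (hu : ContDiff ℝ ∞ u) (hv : ContDiff ℝ ∞ v)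
    (h0 : ∀ x, u x 0 ≠ 0) {b : TwoFun} (hb : ContDiff ℝ ∞ b) :
    coeffDeriv thirdOrderOperator u v b = xDeriv (fluxVar (qVar u v) (sVar u v) b) := by
  have hb1 := contDiff_xDeriv hb
  have hb2 := contDiff_xDeriv hb1
  have sndc : ∀ {f : ℝ → ℝ}, ContDiff ℝ ∞ f → ∀ y : ℝ,
      ContDiffAt ℝ ∞ (fun p : ℝ × ℝ => f p.2) (0, y) := fun hf y =>
    (hf.comp contDiff_snd).contDiffAt
  have cq := contDiffAt_uncurry_qField hu hv h0
  have cs := contDiffAt_uncurry_sField hu hv h0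
  have dq := hasDerivAt_qField_add_smul (u := u) (v := v) h0
  have ds := hasDerivAt_sField_add_smul (u := u) (v := v) h0
  obtain ⟨q1, q2⟩ := deriv_deriv_comm (F := fun t z => qField (u + t • v) z * xDeriv b z 1)
    fun y => (cq y).mul (sndc (contDiff_component hb1 1) y)
  obtain ⟨s1, s2⟩ := deriv_deriv_comm (F := fun t z => sField (u + t • v) z * xDeriv b z 1)
    fun y => (cs y).mul (sndc (contDiff_component hb1 1) y)
  have q3 : ∀ y, deriv (fun t : ℝ => deriv (fun z => qField (u + t • v) z * xDeriv b z 1) y) 0 =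
      deriv (fun z => qVar u v z * xDeriv b z 1) y := fun y => by
    rw [q2]
    congr 1
    funext z
    exact ((dq z).mul_const _).deriv
  have s3 : ∀ y, deriv (fun t : ℝ => deriv (fun z => sField (u + t • v) z * xDeriv b z 1) y) 0 =
      deriv (fun z => sVar u v z * xDeriv b z 1) y := fun y => by
    rw [s2]
    congr 1
    funext z
    exact ((ds z).mul_const _).deriv
  have incl : ∀ y : ℝ, ContDiffAt ℝ ∞ (fun t : ℝ => (t, y)) 0 := fun y =>
    contDiffAt_id.prodMk contDiffAt_const
  have dq1 : ∀ y, DifferentiableAt ℝ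
      (fun t : ℝ => deriv (fun z => qField (u + t • v) z * xDeriv b z 1) y) 0 := fun y =>
    (ContDiffAt.comp (g := Function.uncurry fun t : ℝ => deriv fun z =>
      qField (u + t • v) z * xDeriv b z 1) (0 : ℝ) (q1 y) (incl y)).differentiableAt (by simp)
  have ds1 : ∀ y, DifferentiableAt ℝ
      (fun t : ℝ => deriv (fun z => sField (u + t • v) z * xDeriv b z 1) y) 0 := fun y =>
    (ContDiffAt.comp (g := Function.uncurry fun t : ℝ => deriv fun z =>
      sField (u + t • v) z * xDeriv b z 1) (0 : ℝ) (s1 y) (incl y)).differentiableAt (by simp)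
  funext x i
  simp only [coeffDeriv, thirdOrderOperator_eq_xDeriv]
  fin_cases i
  · have h := (deriv_deriv_comm (F := fun t y => thirdFlux (qField (u + t • v))
      (sField (u + t • v)) b y 0) fun y =>
        (sndc (contDiff_component hb2 0) y).add (q1 y)).2 x
    refine h.trans ?_
    simp only [xDeriv]
    congr 1
    funext y
    change deriv (fun t => xDeriv (xDeriv b) y 0 +
      deriv (fun z => qField (u + t • v) z * xDeriv b z 1) y) 0 = _
    rw [deriv_const_add, q3]
    rfl
  · have h := (deriv_deriv_comm (F := fun t y => thirdFlux (qField (u + t • v))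
      (sField (u + t • v)) b y 1) fun y =>
        ((cq y).mul (sndc (contDiff_component hb2 0) y)).add
          (((cs y).mul (sndc (contDiff_component hb2 1) y)).add (s1 y))).2 x
    refine h.trans ?_
    simp only [xDeriv]
    congr 1
    funext y
    refine HasDerivAt.deriv (((dq y).mul_const _).add (((ds y).mul_const _).add ?_))
    exact (ds1 y).hasDerivAt.congr_deriv (s3 y)

/-- The density through which the variation of the third-order operator in the direction `v` enters
the brackets: the covector `θ_l(a, b) = ∂_l q (a₁'' b₂' - b₁'' a₂') + ∂_l s (a₂'' b₂' - a₂' b₂'')`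
contracted with `v`. No derivative of `v` and no undifferentiated covector remains. -/
noncomputable def thirdDensity (u a b v : TwoFun) : ℝ → ℝ := fun x =>
  qVar u v x * (xDeriv (xDeriv a) x 0 * xDeriv b x 1 - xDeriv (xDeriv b) x 0 * xDeriv a x 1) +
  sVar u v x * (xDeriv (xDeriv a) x 1 * xDeriv b x 1 - xDeriv a x 1 * xDeriv (xDeriv b) x 1)

theorem pairing_coeffDeriv_thirdOrderOperator (hu : ContDiff ℝ ∞ u) (hv : ContDiff ℝ ∞ v)
    (h0 : ∀ x, u x 0 ≠ 0) {a b : TwoFun} (ha : IsTest a) (hb : IsTest b) :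
    pairing a (coeffDeriv thirdOrderOperator u v b) = ∫ x, thirdDensity u a b v x := by
  rw [coeffDeriv_thirdOrderOperator hu hv h0 hb.1]
  have cq := contDiff_qVar hu hv h0
  have cs := contDiff_sVar hu hv h0
  have a0 := hasDerivAt_component ha.1
  have a1 := hasDerivAt_component (contDiff_xDeriv ha.1)
  have b1 := hasDerivAt_component (contDiff_xDeriv hb.1)
  have ca := contDiff_component ha.1
  have ca1 := contDiff_component (contDiff_xDeriv ha.1)
  have ca2 := contDiff_component (contDiff_xDeriv (contDiff_xDeriv ha.1))
  have cb1 := contDiff_component (contDiff_xDeriv hb.1)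
  have cb2 := contDiff_component (contDiff_xDeriv (contDiff_xDeriv hb.1))
  have cf : ContDiff ℝ ∞ (fluxVar (qVar u v) (sVar u v) b) := by
    refine contDiff_pi.2 fun i => ?_
    fin_cases i
    · exact contDiff_deriv (cq.mul (cb1 1))
    · exact (cq.mul (cb2 0)).add ((cs.mul (cb2 1)).add (contDiff_deriv (cs.mul (cb1 1))))
  have hf := hasDerivAt_component cf
  have cf1 := contDiff_component (contDiff_xDeriv cf)
  unfold pairing
  refine integral_eq_of_hasDerivAt_sub (F := fun x =>
      (a x 0 * fluxVar (qVar u v) (sVar u v) b x 0 +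
        a x 1 * fluxVar (qVar u v) (sVar u v) b x 1) -
      (xDeriv a x 0 * (qVar u v x * xDeriv b x 1) + xDeriv a x 1 * (sVar u v x * xDeriv b x 1)))
    (fun x => ?_) ?_ ?_ ha.2 ?_ ?_ ?_
  · have := (((a0 0 x).mul (hf 0 x)).add ((a0 1 x).mul (hf 1 x))).sub
      (((a1 0 x).mul (contDiff_hasDerivAt (cq.mul (cb1 1)) x)).add
        ((a1 1 x).mul (contDiff_hasDerivAt (cs.mul (cb1 1)) x)))
    refine this.congr_deriv ?_
    simp only [Fin.sum_univ_two, thirdDensity, fluxVar, Matrix.cons_val_zero, Matrix.cons_val_one]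
    ring
  · simp only [Fin.sum_univ_two]
    exact (((ca 0).mul (cf1 0)).add ((ca 1).mul (cf1 1))).continuous
  · exact ((cq.mul (((ca2 0).mul (cb1 1)).sub ((cb2 0).mul (ca1 1)))).add
      (cs.mul (((ca2 1).mul (cb1 1)).sub ((ca1 1).mul (cb2 1))))).continuous
  · intro x hx
    simp [eq_zero_of_notMem_tsupport hx, xDeriv_eq_zero_of_notMem hx]
  · intro x hx
    simp [eq_zero_of_notMem_tsupport hx]
  · intro x hx
    simp [thirdDensity, xDeriv_eq_zero_of_notMem hx,
      xDeriv_eq_zero_of_notMem (xDeriv_notMem_tsupport hx)]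

end

/-! ### First-order operators -/

theorem contDiff_comp_field {U : Set (Fin 2 → ℝ)} (hU : IsOpen U) {f : (Fin 2 → ℝ) → ℝ}
    (hf : ContDiffOn ℝ ∞ f U) {u : TwoFun} (hu : IsSmoothField U u) :
    ContDiff ℝ ∞ fun x => f (u x) :=
  contDiff_iff_contDiffAt.2 fun x =>
    (hf.contDiffAt (hU.mem_nhds (hu.2 x))).comp x hu.1.contDiffAt

theorem contDiffOn_partialDeriv {U : Set (Fin 2 → ℝ)} (hU : IsOpen U) {f : (Fin 2 → ℝ) → ℝ}
    (hf : ContDiffOn ℝ ∞ f U) (k : Fin 2) : ContDiffOn ℝ ∞ (partialDeriv k f) U :=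
  (hf.fderiv_of_isOpen hU (by simp)).clm_apply contDiffOn_const

/-- The chain rule along a curve, in terms of partial derivatives. -/
theorem hasDerivAt_comp_curve {f : (Fin 2 → ℝ) → ℝ} {γ : ℝ → Fin 2 → ℝ} {γ' : Fin 2 → ℝ} {t : ℝ}
    (hf : DifferentiableAt ℝ f (γ t)) (hγ : HasDerivAt γ γ' t) :
    HasDerivAt (fun s => f (γ s)) (∑ k, partialDeriv k f (γ t) * γ' k) t := by
  refine (HasFDerivAt.comp_hasDerivAt t hf.hasFDerivAt hγ).congr_deriv ?_
  have : γ' = ∑ k, γ' k • (Pi.single k 1 : Fin 2 → ℝ) := by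
    funext i
    fin_cases i <;> simp [Fin.sum_univ_two]
  conv_lhs => rw [this]
  simp [partialDeriv, Fin.sum_univ_two, mul_comm]

section
variable {U : Set (Fin 2 → ℝ)} {u v : TwoFun}

theorem differentiableAt_of_contDiffOn (hU : IsOpen U) {f : (Fin 2 → ℝ) → ℝ}
    (hf : ContDiffOn ℝ ∞ f U) {p : Fin 2 → ℝ} (hp : p ∈ U) : DifferentiableAt ℝ f p :=
  (hf.contDiffAt (hU.mem_nhds hp)).differentiableAt (by simp)

theorem hasDerivAt_comp_field (hU : IsOpen U) {f : (Fin 2 → ℝ) → ℝ}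
    (hf : ContDiffOn ℝ ∞ f U) (hu : IsSmoothField U u) (x : ℝ) :
    HasDerivAt (fun y => f (u y)) (∑ k, partialDeriv k f (u x) * xDeriv u x k) x :=
  hasDerivAt_comp_curve (differentiableAt_of_contDiffOn hU hf (hu.2 x))
    (hasDerivAt_pi.2 fun k => hasDerivAt_component hu.1 k x)

theorem hasDerivAt_comp_variation (hU : IsOpen U) {f : (Fin 2 → ℝ) → ℝ}
    (hf : ContDiffOn ℝ ∞ f U) (hu : IsSmoothField U u) (v : TwoFun) (x : ℝ) :
    HasDerivAt (fun t : ℝ => f ((u + t • v) x)) (∑ k, partialDeriv k f (u x) * v x k) 0 := by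
  have h := hasDerivAt_comp_curve (f := f) (γ := fun t : ℝ => (u + t • v) x) (γ' := v x) (t := 0)
    (by simpa using differentiableAt_of_contDiffOn hU hf (hu.2 x))
    (hasDerivAt_pi.2 fun k => hasDerivAt_add_smul k x)
  simpa using h

variable {g : Fin 2 → Fin 2 → (Fin 2 → ℝ) → ℝ} {Γ : Fin 2 → Fin 2 → Fin 2 → (Fin 2 → ℝ) → ℝ}

theorem hydroOperator_apply (u ψ : TwoFun) (x : ℝ) (i : Fin 2) :
    hydroOperator g Γ u ψ x i = ∑ j, (g i j (u x) * xDeriv ψ x j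
      + (∑ k, Γ i j k (u x) * xDeriv u x k) * ψ x j) := rfl

theorem contDiff_hydroOperator (hU : IsOpen U) (hg : ∀ i j, ContDiffOn ℝ ∞ (g i j) U)
    (hΓ : ∀ i j k, ContDiffOn ℝ ∞ (Γ i j k) U) (hu : IsSmoothField U u) {c : TwoFun}
    (hc : ContDiff ℝ ∞ c) : ContDiff ℝ ∞ (hydroOperator g Γ u c) :=
  contDiff_pi.2 fun i => ContDiff.sum fun j _ =>
    ((contDiff_comp_field hU (hg i j) hu).mul (contDiff_component (contDiff_xDeriv hc) j)).add
      ((ContDiff.sum fun k _ => (contDiff_comp_field hU (hΓ i j k) hu).mul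
        (contDiff_component (contDiff_xDeriv hu.1) k)).mul (contDiff_component hc j))

theorem coeffDeriv_hydroOperator (hU : IsOpen U) (hg : ∀ i j, ContDiffOn ℝ ∞ (g i j) U)
    (hΓ : ∀ i j k, ContDiffOn ℝ ∞ (Γ i j k) U) (hu : IsSmoothField U u) (hv : ContDiff ℝ ∞ v)
    (b : TwoFun) (x : ℝ) (i : Fin 2) :
    coeffDeriv (hydroOperator g Γ) u v b x i =
      ∑ j, ((∑ l, partialDeriv l (g i j) (u x) * v x l) * xDeriv b x j +
        (∑ k, ((∑ l, partialDeriv l (Γ i j k) (u x) * v x l) * xDeriv u x k +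
          Γ i j k (u x) * xDeriv v x k)) * b x j) := by
  have hd : ∀ k, HasDerivAt (fun t : ℝ => xDeriv (u + t • v) x k) (xDeriv v x k) 0 := fun k => by
    have : (fun t : ℝ => xDeriv (u + t • v) x k) =
        fun t => xDeriv u x k + t * xDeriv v x k := by
      funext t
      exact ((hasDerivAt_component hu.1 k x).add
        ((hasDerivAt_component hv k x).const_mul t)).deriv
    rw [this]
    simpa using ((hasDerivAt_id (0 : ℝ)).mul_const (xDeriv v x k)).const_add (xDeriv u x k)
  refine HasDerivAt.deriv (HasDerivAt.fun_sum fun j _ =>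
    ((hasDerivAt_comp_variation hU (hg i j) hu v x).mul_const _).add
      (HasDerivAt.mul_const (HasDerivAt.fun_sum fun k _ => ?_) _))
  refine ((hasDerivAt_comp_variation hU (hΓ i j k) hu v x).mul (hd k)).congr_deriv ?_
  simp

/-- The covector density through which the variation of a first-order operator in the direction
`v` enters the brackets: `E_l(a, b) v^l` with
`E_l = a_i b_j' (∂_l g^{ij} - Γ^{ij}_l) - a_i' b_j Γ^{ij}_l
  + a_i b_j u^k_x (∂_l Γ^{ij}_k - ∂_k Γ^{ij}_l)`. -/
noncomputable def hydroDensity (g : Fin 2 → Fin 2 → (Fin 2 → ℝ) → ℝ)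
    (Γ : Fin 2 → Fin 2 → Fin 2 → (Fin 2 → ℝ) → ℝ) (u a b v : TwoFun) : ℝ → ℝ := fun x =>
  ∑ i, ∑ j, ∑ l, (a x i * xDeriv b x j * (partialDeriv l (g i j) (u x) - Γ i j l (u x))
    - xDeriv a x i * b x j * Γ i j l (u x)
    + a x i * b x j * ∑ k, xDeriv u x k *
      (partialDeriv l (Γ i j k) (u x) - partialDeriv k (Γ i j l) (u x))) * v x l

theorem contDiff_hydroDensity (hU : IsOpen U) (hg : ∀ i j, ContDiffOn ℝ ∞ (g i j) U)
    (hΓ : ∀ i j k, ContDiffOn ℝ ∞ (Γ i j k) U) (hu : IsSmoothField U u) {a b : TwoFun}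
    (ha : ContDiff ℝ ∞ a) (hb : ContDiff ℝ ∞ b) (hv : ContDiff ℝ ∞ v) :
    ContDiff ℝ ∞ (hydroDensity g Γ u a b v) := by
  have ca := contDiff_component ha
  have ca1 := contDiff_component (contDiff_xDeriv ha)
  have cb := contDiff_component hb
  have cb1 := contDiff_component (contDiff_xDeriv hb)
  have cv := contDiff_component hv
  have cu := contDiff_component (contDiff_xDeriv hu.1)
  refine ContDiff.sum fun i _ => ContDiff.sum fun j _ => ContDiff.sum fun l _ => ?_
  have h1 := contDiff_comp_field hU (contDiffOn_partialDeriv hU (hg i j) l) hu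
  have h2 := contDiff_comp_field hU (hΓ i j l) hu
  have h3 := fun m k => contDiff_comp_field hU (contDiffOn_partialDeriv hU (hΓ i j m) k) hu
  exact (((((ca i).mul (cb1 j)).mul (h1.sub h2)).sub (((ca1 i).mul (cb j)).mul h2)).add
    (((ca i).mul (cb j)).mul (ContDiff.sum fun k _ =>
      (cu k).mul ((h3 k l).sub (h3 l k))))).mul (cv l)

theorem contDiff_thirdDensity (hu : ContDiff ℝ ∞ u) (h0 : ∀ x, u x 0 ≠ 0) {a b : TwoFun}
    (ha : ContDiff ℝ ∞ a) (hb : ContDiff ℝ ∞ b) (hv : ContDiff ℝ ∞ v) :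
    ContDiff ℝ ∞ (thirdDensity u a b v) := by
  have cq := contDiff_qVar hu hv h0
  have cs := contDiff_sVar hu hv h0
  have ca1 := contDiff_component (contDiff_xDeriv ha)
  have ca2 := contDiff_component (contDiff_xDeriv (contDiff_xDeriv ha))
  have cb1 := contDiff_component (contDiff_xDeriv hb)
  have cb2 := contDiff_component (contDiff_xDeriv (contDiff_xDeriv hb))
  exact (cq.mul (((ca2 0).mul (cb1 1)).sub ((cb2 0).mul (ca1 1)))).add
      (cs.mul (((ca2 1).mul (cb1 1)).sub ((ca1 1).mul (cb2 1))))

theorem pairing_coeffDeriv_hydroOperator (hU : IsOpen U) (hg : ∀ i j, ContDiffOn ℝ ∞ (g i j) U)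
    (hΓ : ∀ i j k, ContDiffOn ℝ ∞ (Γ i j k) U) (hu : IsSmoothField U u) (hv : ContDiff ℝ ∞ v)
    {a b : TwoFun} (ha : IsTest a) (hb : IsTest b) :
    pairing a (coeffDeriv (hydroOperator g Γ) u v b) = ∫ x, hydroDensity g Γ u a b v x := by
  have ca := contDiff_component ha.1
  have cb := contDiff_component hb.1
  have cb1 := contDiff_component (contDiff_xDeriv hb.1)
  have cv := contDiff_component hv
  have cv1 := contDiff_component (contDiff_xDeriv hv)
  have cu := contDiff_component (contDiff_xDeriv hu.1)
  have h1 := fun i j l => contDiff_comp_field hU (contDiffOn_partialDeriv hU (hg i j) l) hu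
  have h2 := fun i j l => contDiff_comp_field hU (hΓ i j l) hu
  have h3 := fun i j l k => contDiff_comp_field hU (contDiffOn_partialDeriv hU (hΓ i j l) k) hu
  simp only [pairing, coeffDeriv_hydroOperator hU hg hΓ hu hv]
  refine integral_eq_of_hasDerivAt_sub (F := fun x =>
    ∑ i, ∑ j, ∑ l, a x i * b x j * Γ i j l (u x) * v x l) (fun x => ?_) ?_
    (contDiff_hydroDensity hU hg hΓ hu ha.1 hb.1 hv).continuous ha.2 ?_ ?_ ?_
  · refine (HasDerivAt.fun_sum fun i _ => HasDerivAt.fun_sum fun j _ => HasDerivAt.fun_sum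
      fun l _ => (((hasDerivAt_component ha.1 i x).mul (hasDerivAt_component hb.1 j x)).mul
        (hasDerivAt_comp_field hU (hΓ i j l) hu x)).mul
          (hasDerivAt_component hv l x)).congr_deriv ?_
    simp only [hydroDensity, Fin.sum_univ_two, Pi.mul_apply]
    ring
  · refine (ContDiff.sum fun i _ => (ca i).mul (ContDiff.sum fun j _ => ?_)).continuous
      (𝕜 := ℝ) (n := ∞)
    exact ((ContDiff.sum fun l _ => (h1 i j l).mul (cv l)).mul (cb1 j)).add
      ((ContDiff.sum fun k _ => ((ContDiff.sum fun l _ => (h3 i j k l).mul (cv l)).mul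
        (cu k)).add ((h2 i j k).mul (cv1 k))).mul (cb j))
  · intro x hx
    simp [eq_zero_of_notMem_tsupport hx]
  · intro x hx
    simp [eq_zero_of_notMem_tsupport hx]
  · intro x hx
    simp [hydroDensity, eq_zero_of_notMem_tsupport hx, xDeriv_eq_zero_of_notMem hx]

end

/-! ### Densities of the Jacobiator and of the Schouten bracket -/

section
variable {U : Set (Fin 2 → ℝ)} {u : TwoFun}
  {g : Fin 2 → Fin 2 → (Fin 2 → ℝ) → ℝ} {Γ : Fin 2 → Fin 2 → Fin 2 → (Fin 2 → ℝ) → ℝ}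

/-- The density of the Jacobiator of a first-order operator. -/
noncomputable def jacobiDensity (g : Fin 2 → Fin 2 → (Fin 2 → ℝ) → ℝ)
    (Γ : Fin 2 → Fin 2 → Fin 2 → (Fin 2 → ℝ) → ℝ) (u a b c : TwoFun) : ℝ → ℝ := fun x =>
  hydroDensity g Γ u a b (hydroOperator g Γ u c) x +
    hydroDensity g Γ u b c (hydroOperator g Γ u a) x +
    hydroDensity g Γ u c a (hydroOperator g Γ u b) x

/-- The density of the Schouten bracket of a first-order operator with the third-order one. -/
noncomputable def schoutenDensity (g : Fin 2 → Fin 2 → (Fin 2 → ℝ) → ℝ)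
    (Γ : Fin 2 → Fin 2 → Fin 2 → (Fin 2 → ℝ) → ℝ) (u a b c : TwoFun) : ℝ → ℝ := fun x =>
  (hydroDensity g Γ u a b (thirdOrderOperator u c) x +
    hydroDensity g Γ u b c (thirdOrderOperator u a) x +
    hydroDensity g Γ u c a (thirdOrderOperator u b) x) +
  (thirdDensity u a b (hydroOperator g Γ u c) x +
    thirdDensity u b c (hydroOperator g Γ u a) x +
    thirdDensity u c a (hydroOperator g Γ u b) x)

theorem contDiff_thirdOrderOperator (hu : ContDiff ℝ ∞ u) (h0 : ∀ x, u x 0 ≠ 0) {c : TwoFun}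
    (hc : ContDiff ℝ ∞ c) : ContDiff ℝ ∞ (thirdOrderOperator u c) := by
  rw [thirdOrderOperator_eq_xDeriv]
  exact contDiff_xDeriv (contDiff_thirdFlux (contDiff_qField hu h0) (contDiff_sField hu h0) hc)

/-- The third-order operator with all derivatives carried out. -/
theorem thirdOrderOperator_apply (hu : ContDiff ℝ ∞ u) (h0 : ∀ x, u x 0 ≠ 0) {c : TwoFun}
    (hc : ContDiff ℝ ∞ c) (x : ℝ) :
    thirdOrderOperator u c x =
      ![xDeriv (xDeriv (xDeriv c)) x 0 + qField u x * xDeriv (xDeriv (xDeriv c)) x 1 +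
          2 * deriv (qField u) x * xDeriv (xDeriv c) x 1 +
          deriv (deriv (qField u)) x * xDeriv c x 1,
        qField u x * xDeriv (xDeriv (xDeriv c)) x 0 + deriv (qField u) x * xDeriv (xDeriv c) x 0 +
          2 * sField u x * xDeriv (xDeriv (xDeriv c)) x 1 +
          3 * deriv (sField u) x * xDeriv (xDeriv c) x 1 +
          deriv (deriv (sField u)) x * xDeriv c x 1] := by
  have hq := contDiff_qField hu h0
  have hs := contDiff_sField hu h0
  have dq := contDiff_hasDerivAt hq
  have ds := contDiff_hasDerivAt hs
  have ddq := contDiff_hasDerivAt (contDiff_deriv hq)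
  have dds := contDiff_hasDerivAt (contDiff_deriv hs)
  have c1 := hasDerivAt_component (contDiff_xDeriv hc)
  have c2 := hasDerivAt_component (contDiff_xDeriv (contDiff_xDeriv hc))
  have eq1 : ∀ {f : ℝ → ℝ}, (∀ y, HasDerivAt f (deriv f y) y) → ∀ i,
      deriv (fun z => f z * xDeriv c z i) =
        fun y => deriv f y * xDeriv c y i + f y * xDeriv (xDeriv c) y i := fun hf i =>
    funext fun y => ((hf y).mul (c1 i y)).deriv
  rw [thirdOrderOperator_eq_xDeriv]
  funext i
  fin_cases i
  · refine HasDerivAt.deriv ?_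
    simp only [thirdFlux, eq1 dq]
    refine ((c2 0 x).add (((ddq x).mul (c1 1 x)).add ((dq x).mul (c2 1 x)))).congr_deriv ?_
    simp
    ring
  · refine HasDerivAt.deriv ?_
    simp only [thirdFlux, eq1 ds]
    refine (((dq x).mul (c2 0 x)).add (((ds x).mul (c2 1 x)).add
      (((dds x).mul (c1 1 x)).add ((ds x).mul (c2 1 x))))).congr_deriv ?_
    simp
    ring

theorem hydroDensity_eq_zero_of_notMem {a b v : TwoFun} {x : ℝ} (h : x ∉ tsupport a) :
    hydroDensity g Γ u a b v x = 0 := by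
  simp [hydroDensity, eq_zero_of_notMem_tsupport h, xDeriv_eq_zero_of_notMem h]

theorem thirdDensity_eq_zero_of_notMem {a b v : TwoFun} {x : ℝ} (h : x ∉ tsupport a) :
    thirdDensity u a b v x = 0 := by
  simp [thirdDensity, xDeriv_eq_zero_of_notMem h,
    xDeriv_eq_zero_of_notMem (xDeriv_notMem_tsupport h)]

section
variable (hU : IsOpen U) (hg : ∀ i j, ContDiffOn ℝ ∞ (g i j) U)
  (hΓ : ∀ i j k, ContDiffOn ℝ ∞ (Γ i j k) U) (hu : IsSmoothField U u)
include hU hg hΓ hu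

theorem integrable_hydroDensity {a b v : TwoFun} (ha : IsTest a) (hb : ContDiff ℝ ∞ b)
    (hv : ContDiff ℝ ∞ v) : Integrable (hydroDensity g Γ u a b v) :=
  integrable_of_eq_zero_off (contDiff_hydroDensity hU hg hΓ hu ha.1 hb hv).continuous ha.2
    fun _ => hydroDensity_eq_zero_of_notMem

omit hg hΓ hU in
theorem integrable_thirdDensity (h0 : ∀ p ∈ U, p 0 ≠ 0) {a b v : TwoFun} (ha : IsTest a)
    (hb : ContDiff ℝ ∞ b) (hv : ContDiff ℝ ∞ v) : Integrable (thirdDensity u a b v) :=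
  integrable_of_eq_zero_off (contDiff_thirdDensity hu.1 (fun x => h0 _ (hu.2 x)) ha.1 hb
    hv).continuous ha.2 fun _ => thirdDensity_eq_zero_of_notMem

theorem jacobiator_hydroOperator {a b c : TwoFun} (ha : IsTest a) (hb : IsTest b)
    (hc : IsTest c) :
    jacobiator (hydroOperator g Γ) (hydroOperator g Γ) u a b c =
      ∫ x, jacobiDensity g Γ u a b c x := by
  have P := fun c (hc : IsTest c) => contDiff_hydroOperator hU hg hΓ hu hc.1
  have i1 := integrable_hydroDensity hU hg hΓ hu ha hb.1 (P c hc)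
  have i2 := integrable_hydroDensity hU hg hΓ hu hb hc.1 (P a ha)
  have i3 := integrable_hydroDensity hU hg hΓ hu hc ha.1 (P b hb)
  simp only [jacobiator, iteratedBracket, jacobiDensity]
  rw [pairing_coeffDeriv_hydroOperator hU hg hΓ hu (P c hc) ha hb,
    pairing_coeffDeriv_hydroOperator hU hg hΓ hu (P a ha) hb hc,
    pairing_coeffDeriv_hydroOperator hU hg hΓ hu (P b hb) hc ha]
  exact ((integral_add (i1.add i2) i3).trans (by rw [← integral_add i1 i2]; rfl)).symm

theorem jacobiator_add_jacobiator (h0 : ∀ p ∈ U, p 0 ≠ 0) {a b c : TwoFun} (ha : IsTest a)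
    (hb : IsTest b) (hc : IsTest c) :
    jacobiator (hydroOperator g Γ) thirdOrderOperator u a b c +
      jacobiator thirdOrderOperator (hydroOperator g Γ) u a b c =
      ∫ x, schoutenDensity g Γ u a b c x := by
  have hu0 : ∀ x, u x 0 ≠ 0 := fun x => h0 _ (hu.2 x)
  have P := fun c (hc : IsTest c) => contDiff_hydroOperator hU hg hΓ hu hc.1
  have R := fun c (hc : IsTest c) => contDiff_thirdOrderOperator hu.1 hu0 hc.1
  have i1 := integrable_hydroDensity hU hg hΓ hu ha hb.1 (R c hc)
  have i2 := integrable_hydroDensity hU hg hΓ hu hb hc.1 (R a ha)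
  have i3 := integrable_hydroDensity hU hg hΓ hu hc ha.1 (R b hb)
  have j1 := integrable_thirdDensity hu h0 ha hb.1 (P c hc)
  have j2 := integrable_thirdDensity hu h0 hb hc.1 (P a ha)
  have j3 := integrable_thirdDensity hu h0 hc ha.1 (P b hb)
  simp only [jacobiator, iteratedBracket, schoutenDensity]
  rw [pairing_coeffDeriv_hydroOperator hU hg hΓ hu (R c hc) ha hb,
    pairing_coeffDeriv_hydroOperator hU hg hΓ hu (R a ha) hb hc,
    pairing_coeffDeriv_hydroOperator hU hg hΓ hu (R b hb) hc ha,
    pairing_coeffDeriv_thirdOrderOperator hu.1 (P c hc) hu0 ha hb,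
    pairing_coeffDeriv_thirdOrderOperator hu.1 (P a ha) hu0 hb hc,
    pairing_coeffDeriv_thirdOrderOperator hu.1 (P b hb) hu0 hc ha]
  refine Eq.symm ((integral_add ((i1.add i2).add i3) ((j1.add j2).add j3)).trans ?_)
  congr 1
  · exact (integral_add (i1.add i2) i3).trans (by rw [← integral_add i1 i2]; rfl)
  · exact (integral_add (j1.add j2) j3).trans (by rw [← integral_add j1 j2]; rfl)

end

/-- A density depending on three covectors that only involves their germs at each point and
vanishes when the third covector does. -/
structure IsLocalDensity (T : TwoFun → TwoFun → TwoFun → ℝ → ℝ) : Prop where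
  congr : ∀ {a a' b b' c c' : TwoFun} {x : ℝ}, a =ᶠ[𝓝 x] a' → b =ᶠ[𝓝 x] b' → c =ᶠ[𝓝 x] c' →
    T a b c x = T a' b' c' x
  map_zero : ∀ a b x, T a b 0 x = 0

/-- Two of the three covectors need not have compact support: multiplying them by a cut-off that
equals `1` near the support of the third does not change the density. -/
theorem IsLocalDensity.integral_eq_zero {T : TwoFun → TwoFun → TwoFun → ℝ → ℝ}
    (hT : IsLocalDensity T)
    (H : ∀ a b c, IsTest a → IsTest b → IsTest c → ∫ x, T a b c x = 0) {a b c : TwoFun}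
    (ha : ContDiff ℝ ∞ a) (hb : ContDiff ℝ ∞ b) (hc : IsTest c) : ∫ x, T a b c x = 0 := by
  obtain ⟨r, hr⟩ := hc.2.isBounded.subset_ball (0 : ℝ)
  have hr0 : 0 < max r 1 := by positivity
  let χ : ContDiffBump (0 : ℝ) := ⟨max r 1, max r 1 + 1, hr0, by linarith⟩
  have hχ : ContDiff ℝ ∞ χ := χ.contDiff
  have cut : ∀ {f : TwoFun}, ContDiff ℝ ∞ f → IsTest (fun x => χ x • f x) := fun hf =>
    ⟨hχ.smul hf, χ.hasCompactSupport.smul_right⟩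
  rw [← H _ _ c (cut ha) (cut hb) hc]
  congr 1
  funext x
  by_cases hx : x ∈ tsupport c
  · have hev : (χ : ℝ → ℝ) =ᶠ[𝓝 x] 1 :=
      χ.eventuallyEq_one_of_mem_ball (Metric.ball_subset_ball (le_max_left _ _) (hr hx))
    have key : ∀ f : TwoFun, f =ᶠ[𝓝 x] fun y => χ y • f y := fun f =>
      hev.mono fun y hy => by simp [hy]
    exact hT.congr (key a) (key b) EventuallyEq.rfl
  · have hev := notMem_tsupport_iff_eventuallyEq.1 hx
    rw [hT.congr EventuallyEq.rfl EventuallyEq.rfl hev, hT.map_zero,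
      hT.congr EventuallyEq.rfl EventuallyEq.rfl hev, hT.map_zero]

theorem hydroDensity_congr {a a' b b' v v' : TwoFun} {x : ℝ} (ha : a =ᶠ[𝓝 x] a')
    (hb : b =ᶠ[𝓝 x] b') (hv : v x = v' x) :
    hydroDensity g Γ u a b v x = hydroDensity g Γ u a' b' v' x := by
  simp only [hydroDensity, ha.eq_of_nhds, hb.eq_of_nhds, (xDeriv_congr ha).eq_of_nhds,
    (xDeriv_congr hb).eq_of_nhds, hv]

theorem thirdDensity_congr {a a' b b' v v' : TwoFun} {x : ℝ} (ha : a =ᶠ[𝓝 x] a')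
    (hb : b =ᶠ[𝓝 x] b') (hv : v x = v' x) :
    thirdDensity u a b v x = thirdDensity u a' b' v' x := by
  simp only [thirdDensity, qVar, sVar, (xDeriv_congr ha).eq_of_nhds,
    (xDeriv_congr hb).eq_of_nhds, (xDeriv_congr (xDeriv_congr ha)).eq_of_nhds,
    (xDeriv_congr (xDeriv_congr hb)).eq_of_nhds, hv]

theorem hydroOperator_congr {c c' : TwoFun} {x : ℝ} (hc : c =ᶠ[𝓝 x] c') :
    hydroOperator g Γ u c x = hydroOperator g Γ u c' x := by
  funext i
  simp only [hydroOperator_apply, hc.eq_of_nhds, (xDeriv_congr hc).eq_of_nhds]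

theorem thirdFlux_congr {q s : ℝ → ℝ} {c c' : TwoFun} {x : ℝ} (hc : c =ᶠ[𝓝 x] c') :
    thirdFlux q s c =ᶠ[𝓝 x] thirdFlux q s c' := by
  filter_upwards [xDeriv_congr (xDeriv_congr hc), (xDeriv_congr hc).eventuallyEq_nhds] with y h2 h1
  have e : ∀ f : ℝ → ℝ, deriv (fun z => f z * xDeriv c z 1) y =
      deriv (fun z => f z * xDeriv c' z 1) y := fun f =>
    Filter.EventuallyEq.deriv_eq (h1.mono fun z hz => by simp only [hz])
  simp only [thirdFlux, h2, e]

theorem thirdOrderOperator_congr {c c' : TwoFun} {x : ℝ} (hc : c =ᶠ[𝓝 x] c') :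
    thirdOrderOperator u c x = thirdOrderOperator u c' x := by
  rw [thirdOrderOperator_eq_xDeriv, thirdOrderOperator_eq_xDeriv]
  exact (xDeriv_congr (thirdFlux_congr hc)).eq_of_nhds

theorem hydroOperator_zero : hydroOperator g Γ u 0 = 0 := by
  funext x i
  simp [hydroOperator_apply, xDeriv_zero]

theorem thirdOrderOperator_zero : thirdOrderOperator u 0 = 0 := by
  have : thirdFlux (qField u) (sField u) 0 = 0 := by
    funext x i
    fin_cases i <;> simp [thirdFlux, xDeriv_zero]
  rw [thirdOrderOperator_eq_xDeriv, this, xDeriv_zero]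

theorem isLocalDensity_jacobiDensity : IsLocalDensity (jacobiDensity g Γ u) where
  congr ha hb hc := by
    simp only [jacobiDensity]
    rw [hydroDensity_congr ha hb (hydroOperator_congr hc),
      hydroDensity_congr hb hc (hydroOperator_congr ha),
      hydroDensity_congr hc ha (hydroOperator_congr hb)]
  map_zero a b x := by
    simp [jacobiDensity, hydroDensity, hydroOperator_zero, xDeriv_zero]

theorem isLocalDensity_schoutenDensity : IsLocalDensity (schoutenDensity g Γ u) where
  congr ha hb hc := by
    simp only [schoutenDensity]
    rw [hydroDensity_congr ha hb (thirdOrderOperator_congr hc),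
      hydroDensity_congr hb hc (thirdOrderOperator_congr ha),
      hydroDensity_congr hc ha (thirdOrderOperator_congr hb),
      thirdDensity_congr ha hb (hydroOperator_congr hc),
      thirdDensity_congr hb hc (hydroOperator_congr ha),
      thirdDensity_congr hc ha (hydroOperator_congr hb)]
  map_zero a b x := by
    simp [schoutenDensity, hydroDensity, thirdDensity, qVar, sVar, hydroOperator_zero,
      thirdOrderOperator_zero, xDeriv_zero]

section
variable (hU : IsOpen U) (hg : ∀ i j, ContDiffOn ℝ ∞ (g i j) U)
  (hΓ : ∀ i j k, ContDiffOn ℝ ∞ (Γ i j k) U)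
include hU hg hΓ

theorem IsHamiltonian.integral_jacobiDensity (h : IsHamiltonian U (hydroOperator g Γ))
    (hu : IsSmoothField U u) {a b c : TwoFun} (ha : ContDiff ℝ ∞ a) (hb : ContDiff ℝ ∞ b)
    (hc : IsTest c) : ∫ x, jacobiDensity g Γ u a b c x = 0 :=
  isLocalDensity_jacobiDensity.integral_eq_zero (fun a b c ha hb hc => by
    rw [← jacobiator_hydroOperator hU hg hΓ hu ha hb hc]
    exact h.2 u hu a b c ha hb hc) ha hb hc

theorem SchoutenBracketVanishes.integral_schoutenDensity (h0 : ∀ p ∈ U, p 0 ≠ 0)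
    (h : SchoutenBracketVanishes U (hydroOperator g Γ) thirdOrderOperator)
    (hu : IsSmoothField U u) {a b c : TwoFun} (ha : ContDiff ℝ ∞ a) (hb : ContDiff ℝ ∞ b)
    (hc : IsTest c) : ∫ x, schoutenDensity g Γ u a b c x = 0 :=
  isLocalDensity_schoutenDensity.integral_eq_zero (fun a b c ha hb hc => by
    rw [← jacobiator_add_jacobiator hU hg hΓ hu h0 ha hb hc]
    exact h u hu a b c ha hb hc) ha hb hc

end
end

/-! ### Special fields and covectors -/

theorem contDiff_vec {f h : ℝ → ℝ} (hf : ContDiff ℝ ∞ f) (hh : ContDiff ℝ ∞ h) :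
    ContDiff ℝ ∞ (fun y => ![f y, h y] : TwoFun) := by
  refine contDiff_pi.2 fun i => ?_
  fin_cases i
  · exact hf
  · exact hh

theorem xDeriv_vec (f h : ℝ → ℝ) :
    xDeriv (fun y => ![f y, h y]) = fun y => ![deriv f y, deriv h y] := by
  funext x i
  fin_cases i <;> rfl

theorem isTest_vec {f h : ℝ → ℝ} (hf : ContDiff ℝ ∞ f) (hh : ContDiff ℝ ∞ h)
    (hfc : HasCompactSupport f) (hhc : HasCompactSupport h) :
    IsTest (fun y => ![f y, h y]) := by
  refine ⟨contDiff_vec hf hh, HasCompactSupport.intro (hfc.union hhc) fun x hx => ?_⟩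
  rw [image_eq_zero_of_notMem_tsupport fun h' => hx (Or.inl h'),
    image_eq_zero_of_notMem_tsupport fun h' => hx (Or.inr h')]
  funext i
  fin_cases i <;> rfl

theorem isTest_vec_left {f : ℝ → ℝ} (hf : ContDiff ℝ ∞ f) (hfc : HasCompactSupport f) :
    IsTest (fun y => ![f y, 0]) :=
  isTest_vec hf contDiff_const hfc HasCompactSupport.zero

theorem isTest_vec_right {f : ℝ → ℝ} (hf : ContDiff ℝ ∞ f) (hfc : HasCompactSupport f) :
    IsTest (fun y => ![0, f y]) :=
  isTest_vec contDiff_const hf HasCompactSupport.zero hfc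

theorem isTest_single {f : ℝ → ℝ} (hf : ContDiff ℝ ∞ f) (hfc : HasCompactSupport f) (i : Fin 2) :
    IsTest (fun y => Pi.single i (f y)) := by
  fin_cases i
  · convert isTest_vec_left hf hfc using 2
    funext j
    fin_cases j <;> rfl
  · convert isTest_vec_right hf hfc using 2
    funext j
    fin_cases j <;> rfl

theorem xDeriv_single (f : ℝ → ℝ) (i j : Fin 2) (x : ℝ) :
    xDeriv (fun y => Pi.single i (f y)) x j = if j = i then deriv f x else 0 := by
  by_cases hij : j = i
  · subst hij
    simp [xDeriv]
  · simp [xDeriv, hij]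

theorem xDeriv_const (p : Fin 2 → ℝ) : xDeriv (fun _ => p) = fun _ => 0 := by
  funext x i
  simp [xDeriv]

theorem isSmoothField_const {U : Set (Fin 2 → ℝ)} {p : Fin 2 → ℝ} (hp : p ∈ U) :
    IsSmoothField U fun _ => p :=
  ⟨contDiff_const, fun _ => hp⟩

/-- On constant fields the third-order operator has constant coefficients. -/
theorem thirdOrderOperator_const {p : Fin 2 → ℝ} (h0 : p 0 ≠ 0) {f h : ℝ → ℝ}
    (hf : ContDiff ℝ ∞ f) (hh : ContDiff ℝ ∞ h) :
    thirdOrderOperator (fun _ => p) (fun y => ![f y, h y]) = fun x =>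
      ![deriv (deriv (deriv f)) x + p 1 / p 0 * deriv (deriv (deriv h)) x,
        p 1 / p 0 * deriv (deriv (deriv f)) x +
          (p 1 ^ 2 + 1) / p 0 ^ 2 * deriv (deriv (deriv h)) x] := by
  funext x
  rw [thirdOrderOperator_apply contDiff_const (fun _ => h0) (contDiff_vec hf hh)]
  have h1 : qField (fun _ => p) = fun _ => p 1 / p 0 := rfl
  have h2 : sField (fun _ => p) = fun _ => (p 1 ^ 2 + 1) / (2 * p 0 ^ 2) := rfl
  have h3 : 2 * ((p 1 ^ 2 + 1) / (2 * p 0 ^ 2)) = (p 1 ^ 2 + 1) / p 0 ^ 2 := by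
    field_simp
  simp [h1, h2, h3, xDeriv_vec]

/-- Through each point of `U` passes a field with prescribed direction at `x = 0` that is constant
for large `|x|`: move along a line, with the profile `x ↦ x` cut off by a bump function. -/
theorem exists_field {U : Set (Fin 2 → ℝ)} (hU : IsOpen U) {p : Fin 2 → ℝ} (hp : p ∈ U)
    (v : Fin 2 → ℝ) : ∃ w : ℝ → ℝ, ContDiff ℝ ∞ w ∧ HasCompactSupport w ∧ w 0 = 0 ∧
      deriv w 0 ≠ 0 ∧ IsSmoothField U fun x => p + w x • v := by
  let χ : ContDiffBump (0 : ℝ) := ⟨1, 2, one_pos, one_lt_two⟩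
  have hχ : ContDiff ℝ ∞ χ := χ.contDiff
  have hw : ContDiff ℝ ∞ fun x : ℝ => x * χ x := contDiff_id.mul hχ
  have hwc : HasCompactSupport fun x : ℝ => x * χ x := χ.hasCompactSupport.mul_left
  obtain ⟨C, hC⟩ := hwc.exists_bound_of_continuous hw.continuous
  have hcont : ContinuousAt (fun t : ℝ => p + t • v) 0 := by fun_prop
  have hnh : ∀ᶠ t in 𝓝 (0 : ℝ), p + t • v ∈ U :=
    hcont.eventually (hU.mem_nhds (by simpa using hp))
  obtain ⟨δ, hδ, hball⟩ := Metric.eventually_nhds_iff.1 hnh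
  have hC0 : 0 ≤ C := (norm_nonneg _).trans (hC 0)
  have hε : 0 < δ / (C + 1) := by positivity
  have hd : HasDerivAt (fun x : ℝ => δ / (C + 1) * (x * χ x)) (δ / (C + 1)) 0 := by
    have h1 : (fun x : ℝ => δ / (C + 1) * (x * χ x)) =ᶠ[𝓝 0] fun x => δ / (C + 1) * x :=
      χ.eventuallyEq_one.mono fun x hx => by simp [hx]
    simpa using ((hasDerivAt_id (0 : ℝ)).const_mul (δ / (C + 1))).congr_of_eventuallyEq h1
  refine ⟨fun x => δ / (C + 1) * (x * χ x), contDiff_const.mul hw, hwc.mul_left, by simp,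
    by rw [hd.deriv]; exact hε.ne', contDiff_const.add ((contDiff_const.mul hw).smul
      contDiff_const), fun x => hball ?_⟩
  rw [dist_zero_right, norm_mul, Real.norm_of_nonneg hε.le]
  calc δ / (C + 1) * ‖x * χ x‖ ≤ δ / (C + 1) * C := by gcongr; exact hC x
    _ < δ / (C + 1) * (C + 1) := by gcongr; linarith
    _ = δ := by field_simp

theorem xDeriv_line {p v : Fin 2 → ℝ} {w : ℝ → ℝ} (hw : ContDiff ℝ ∞ w) (x : ℝ) (k : Fin 2) :
    xDeriv (fun x => p + w x • v) x k = deriv w x * v k :=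
  (((contDiff_hasDerivAt hw x).mul_const (v k)).const_add (p k)).deriv

/-- Integrating by parts, `∫ x³ ψ''' = -6 ∫ ψ` and `∫ x ψ' = -∫ ψ`; so the vanishing of an integral
with monomial weights is one linear relation between the coefficients. Evaluated on polynomial
covectors at a constant field, the brackets produce such integrals. -/
theorem moment_relation {A B C : ℝ}
    (H : ∀ ψ : ℝ → ℝ, ContDiff ℝ ∞ ψ → HasCompactSupport ψ →
      ∫ x, (A * x ^ 3 * deriv (deriv (deriv ψ)) x + B * x * deriv ψ x + C * ψ x) = 0) :
    -6 * A - B + C = 0 := by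
  let χ : ContDiffBump (0 : ℝ) := ⟨1, 2, one_pos, one_lt_two⟩
  have hψ : ContDiff ℝ ∞ χ := χ.contDiff
  have hc : HasCompactSupport χ := χ.hasCompactSupport
  have d0 := contDiff_hasDerivAt hψ
  have h1 := contDiff_deriv hψ
  have d1 := contDiff_hasDerivAt h1
  have h2 := contDiff_deriv h1
  have d2 := contDiff_hasDerivAt h2
  have c0 := hψ.continuous
  have c1 := h1.continuous
  have c3 := (contDiff_deriv h2).continuous
  have z0 : ∀ x ∉ tsupport χ, χ x = 0 := fun x hx => image_eq_zero_of_notMem_tsupport hx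
  have z1 : ∀ x ∉ tsupport χ, deriv χ x = 0 := fun x hx =>
    image_eq_zero_of_notMem_tsupport fun h => hx (tsupport_deriv_subset h)
  have z2 : ∀ x ∉ tsupport χ, deriv (deriv χ) x = 0 := fun x hx =>
    image_eq_zero_of_notMem_tsupport fun h =>
      hx (tsupport_deriv_subset (tsupport_deriv_subset h))
  have z3 : ∀ x ∉ tsupport χ, deriv (deriv (deriv χ)) x = 0 := fun x hx =>
    image_eq_zero_of_notMem_tsupport fun h =>
      hx (tsupport_deriv_subset (tsupport_deriv_subset (tsupport_deriv_subset h)))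
  have e := integral_eq_of_hasDerivAt_sub
    (F := fun x => A * (x ^ 3 * deriv (deriv χ) x - 3 * x ^ 2 * deriv χ x + 6 * x * χ x) +
      B * x * χ x)
    (f := fun x => A * x ^ 3 * deriv (deriv (deriv χ)) x + B * x * deriv χ x + C * χ x)
    (g := fun x => (-6 * A - B + C) * χ x) (fun x => ?_) (by fun_prop) (by fun_prop) hc
    (fun x hx => by simp [z0 x hx, z1 x hx, z2 x hx])
    (fun x hx => by simp [z0 x hx, z1 x hx, z3 x hx])
    (fun x hx => by simp [z0 x hx])
  · rw [H χ hψ hc, integral_const_mul] at e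
    exact (mul_eq_zero.1 e.symm).resolve_right (χ.integral_pos (μ := volume)).ne'
  · have i := hasDerivAt_id x
    refine ((((((i.pow 3).mul (d2 x)).sub (((i.pow 2).const_mul 3).mul (d1 x))).add
      ((i.const_mul 6).mul (d0 x))).const_mul A).add ((i.const_mul B).mul (d0 x))).congr_deriv ?_
    simp
    ring

/-! ### Skew-adjointness -/

section
variable {U : Set (Fin 2 → ℝ)} {u : TwoFun}
  {g : Fin 2 → Fin 2 → (Fin 2 → ℝ) → ℝ} {Γ : Fin 2 → Fin 2 → Fin 2 → (Fin 2 → ℝ) → ℝ}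

/-- The pointwise defect of skew-adjointness of a first-order operator `P`: the value on `b` of
`P + P*`, a first-order operator again. -/
noncomputable def skewDefect (g : Fin 2 → Fin 2 → (Fin 2 → ℝ) → ℝ)
    (Γ : Fin 2 → Fin 2 → Fin 2 → (Fin 2 → ℝ) → ℝ) (u b : TwoFun) : TwoFun := fun x i =>
  ∑ j, ((g i j (u x) - g j i (u x)) * xDeriv b x j +
    (∑ k, (Γ i j k (u x) + Γ j i k (u x) - partialDeriv k (g j i) (u x)) * xDeriv u x k) * b x j)

variable (hU : IsOpen U) (hg : ∀ i j, ContDiffOn ℝ ∞ (g i j) U)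
  (hΓ : ∀ i j k, ContDiffOn ℝ ∞ (Γ i j k) U)
include hU hg hΓ

theorem pairing_add_pairing_hydroOperator (hu : IsSmoothField U u) {a b : TwoFun} (ha : IsTest a)
    (hb : IsTest b) :
    pairing a (hydroOperator g Γ u b) + pairing (hydroOperator g Γ u a) b =
      pairing a (skewDefect g Γ u b) := by
  have ca := contDiff_component ha.1
  have cb := contDiff_component hb.1
  have cb1 := contDiff_component (contDiff_xDeriv hb.1)
  have cu := contDiff_component (contDiff_xDeriv hu.1)
  have h1 := fun i j l => contDiff_comp_field hU (contDiffOn_partialDeriv hU (hg i j) l) hu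
  have h2 := fun i j l => contDiff_comp_field hU (hΓ i j l) hu
  have h3 := fun i j => contDiff_comp_field hU (hg i j) hu
  have cP := contDiff_component (contDiff_hydroOperator hU hg hΓ hu hb.1)
  have cPa := contDiff_component (contDiff_hydroOperator hU hg hΓ hu ha.1)
  have cf : ContDiff ℝ ∞ fun x => ∑ i, a x i * hydroOperator g Γ u b x i :=
    ContDiff.sum fun i _ => (ca i).mul (cP i)
  have cf' : ContDiff ℝ ∞ fun x => ∑ i, hydroOperator g Γ u a x i * b x i :=
    ContDiff.sum fun i _ => (cPa i).mul (cb i)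
  unfold pairing
  rw [← integral_add (integrable_of_eq_zero_off cf.continuous ha.2 fun x hx => by
      simp [eq_zero_of_notMem_tsupport hx]) (integrable_of_eq_zero_off cf'.continuous hb.2
      fun x hx => by simp [eq_zero_of_notMem_tsupport hx])]
  refine integral_eq_of_hasDerivAt_sub (F := fun x => ∑ i, ∑ j, g i j (u x) * a x j * b x i)
    (fun x => ?_) (cf.add cf').continuous ?_ ha.2 ?_ ?_ ?_
  · refine (HasDerivAt.fun_sum fun i _ => HasDerivAt.fun_sum fun j _ =>
      ((hasDerivAt_comp_field hU (hg i j) hu x).mul (hasDerivAt_component ha.1 j x)).mul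
        (hasDerivAt_component hb.1 i x)).congr_deriv ?_
    simp only [skewDefect, hydroOperator_apply, Fin.sum_univ_two, Pi.mul_apply]
    ring
  · refine (ContDiff.sum fun i _ => (ca i).mul (ContDiff.sum fun j _ => ?_)).continuous
      (𝕜 := ℝ) (n := ∞)
    exact (((h3 i j).sub (h3 j i)).mul (cb1 j)).add ((ContDiff.sum fun k _ =>
      (((h2 i j k).add (h2 j i k)).sub (h1 j i k)).mul (cu k)).mul (cb j))
  · intro x hx
    simp [eq_zero_of_notMem_tsupport hx]
  · intro x hx
    simp [hydroOperator_apply, eq_zero_of_notMem_tsupport hx, xDeriv_eq_zero_of_notMem hx]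
  · intro x hx
    simp [eq_zero_of_notMem_tsupport hx]

/-- For a skew-adjoint operator the defect vanishes pointwise, since it pairs to zero with every
test covector. -/
theorem skewDefect_eq_zero (h : IsSkewAdjoint U (hydroOperator g Γ)) (hu : IsSmoothField U u)
    {b : TwoFun} (hb : IsTest b) (x : ℝ) (i : Fin 2) : skewDefect g Γ u b x i = 0 := by
  have cb := contDiff_component hb.1
  have cb1 := contDiff_component (contDiff_xDeriv hb.1)
  have cu := contDiff_component (contDiff_xDeriv hu.1)
  have h1 := fun i j l => contDiff_comp_field hU (contDiffOn_partialDeriv hU (hg i j) l) hu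
  have h2 := fun i j l => contDiff_comp_field hU (hΓ i j l) hu
  have h3 := fun i j => contDiff_comp_field hU (hg i j) hu
  have cs : ContDiff ℝ ∞ fun x => skewDefect g Γ u b x i := ContDiff.sum fun j _ =>
    (((h3 i j).sub (h3 j i)).mul (cb1 j)).add ((ContDiff.sum fun k _ =>
      (((h2 i j k).add (h2 j i k)).sub (h1 j i k)).mul (cu k)).mul (cb j))
  refine eq_zero_of_forall_integral_mul_test cs.continuous (fun ψ hψ hψc => ?_) x
  have ha : IsTest (fun y => Pi.single i (ψ y)) := isTest_single hψ hψc i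
  have := pairing_add_pairing_hydroOperator hU hg hΓ hu ha hb
  rw [h u hu _ b ha hb, neg_add_cancel] at this
  rw [this]
  simp [pairing, Pi.single_apply, mul_comm]

/-- Skew-adjointness makes `g` symmetric and compatible with `Γ`. The first half comes from a
constant field and a covector with prescribed derivative at `0`, the second from a field with
prescribed direction and a covector that is constant near `0`. -/
theorem symm_of_isSkewAdjoint (h : IsSkewAdjoint U (hydroOperator g Γ)) {p : Fin 2 → ℝ}
    (hp : p ∈ U) (i j k : Fin 2) :
    g i j p = g j i p ∧ partialDeriv k (g i j) p = Γ i j k p + Γ j i k p := by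
  let χ : ContDiffBump (0 : ℝ) := ⟨1, 2, one_pos, one_lt_two⟩
  have hχ : ContDiff ℝ ∞ χ := χ.contDiff
  have hχc : HasCompactSupport χ := χ.hasCompactSupport
  have hd1 : deriv χ 0 = 0 := by
    have := χ.eventuallyEq_one.deriv_eq
    simpa using this
  have hd2 : deriv (fun x => x * χ x) 0 = 1 := by
    have : (fun x : ℝ => x * χ x) =ᶠ[𝓝 0] fun x => x :=
      χ.eventuallyEq_one.mono fun x hx => by simp [hx]
    simpa using this.deriv_eq
  have hχ0 : χ 0 = 1 := χ.eventuallyEq_one.eq_of_nhds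
  refine ⟨?_, ?_⟩
  · have := skewDefect_eq_zero hU hg hΓ h (isSmoothField_const hp)
      (isTest_single (contDiff_id.mul hχ) hχc.mul_left j) 0 i
    simp [skewDefect, xDeriv_single, xDeriv_const, hd2] at this
    linarith
  · obtain ⟨w, hw, -, hw0, hw1, hu⟩ := exists_field hU hp (Pi.single k 1)
    have := skewDefect_eq_zero hU hg hΓ h hu (isTest_single hχ hχc i) 0 j
    simp [skewDefect, xDeriv_single, hd1, xDeriv_line hw, hw0, hχ0, Pi.single_apply, hw1] at this
    linarith

end

/-! ### Pointwise consequences at constant fields -/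

theorem deriv_pow_three_div : deriv (fun y : ℝ => y ^ 3 / 6) = fun y => y ^ 2 / 2 := by
  funext x
  simp
  ring

theorem deriv_pow_two_div : deriv (fun y : ℝ => y ^ 2 / 2) = fun y => y := by
  funext x
  simp

theorem deriv_pow_four_div : deriv (fun y : ℝ => y ^ 4 / 24) = fun y => y ^ 3 / 6 := by
  funext x
  simp
  ring

section
variable {U : Set (Fin 2 → ℝ)} {u : TwoFun}
  {g : Fin 2 → Fin 2 → (Fin 2 → ℝ) → ℝ} {Γ : Fin 2 → Fin 2 → Fin 2 → (Fin 2 → ℝ) → ℝ}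
  (hU : IsOpen U) (hg : ∀ i j, ContDiffOn ℝ ∞ (g i j) U)
  (hΓ : ∀ i j k, ContDiffOn ℝ ∞ (Γ i j k) U)
  (hS : ∀ p ∈ U, ∀ i j k, partialDeriv k (g i j) p = Γ i j k p + Γ j i k p)
include hU hg hΓ hS

/-- Evaluating the Jacobiator at a constant field on a constant covector and two covectors with
one component each gives the torsion condition of the Levi-Civita connection. -/
theorem torsion_of_isHamiltonian (h : IsHamiltonian U (hydroOperator g Γ)) {p : Fin 2 → ℝ}
    (hp : p ∈ U) (i : Fin 2) :
    Γ 0 i 0 p * g 0 1 p + Γ 0 i 1 p * g 1 1 p = Γ 1 i 0 p * g 0 0 p + Γ 1 i 1 p * g 1 0 p := by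
  set D := fun i => Γ 0 i 0 p * g 0 1 p + Γ 0 i 1 p * g 1 1 p -
    (Γ 1 i 0 p * g 0 0 p + Γ 1 i 1 p * g 1 0 p) with hD
  have key : ∀ w₀ w₁ : ℝ, w₀ * D 0 + w₁ * D 1 = 0 := by
    intro w₀ w₁
    have := moment_relation (A := 0) (B := w₀ * D 0 + w₁ * D 1) (C := 0) fun ψ hψ hψc => by
      refine Eq.trans ?_ (h.integral_jacobiDensity hU hg hΓ (isSmoothField_const hp)
          (a := fun _ => ![w₀, w₁]) (b := fun y => ![y ^ 2 / 2, 0]) (c := fun y => ![0, ψ y])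
          contDiff_const (contDiff_vec (by fun_prop) contDiff_const) (isTest_vec_right hψ hψc))
      congr 1
      funext x
      simp [jacobiDensity, hydroDensity, hydroOperator_apply, xDeriv_vec, xDeriv_const,
        Fin.sum_univ_two, hS p hp, hD]
      ring
    linarith
  have h0 := key 1 0
  have h1 := key 0 1
  fin_cases i <;> simp [hD] at h0 h1 ⊢ <;> linarith

section
variable (h0 : ∀ p ∈ U, p 0 ≠ 0)
  (hT : SchoutenBracketVanishes U (hydroOperator g Γ) thirdOrderOperator)
include h0 hT

/-- Compatibility at constant fields, with one constant covector: contracting `Γ` with the leading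
coefficient of the third-order operator gives symmetric matrices. -/
theorem leading_symm {p : Fin 2 → ℝ} (hp : p ∈ U) (i : Fin 2) :
    p 1 / p 0 * Γ 0 i 0 p + (p 1 ^ 2 + 1) / p 0 ^ 2 * Γ 0 i 1 p =
      Γ 1 i 0 p + p 1 / p 0 * Γ 1 i 1 p := by
  set D := fun i => p 1 / p 0 * Γ 0 i 0 p + (p 1 ^ 2 + 1) / p 0 ^ 2 * Γ 0 i 1 p with hD
  set E := fun i => Γ 1 i 0 p + p 1 / p 0 * Γ 1 i 1 p with hE
  have key : ∀ w₀ w₁ : ℝ, w₀ * (D 0 - E 0) + w₁ * (D 1 - E 1) = 0 := by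
    intro w₀ w₁
    have := moment_relation (A := (w₀ * D 0 + w₁ * D 1) / 6) (B := -(w₀ * E 0 + w₁ * E 1))
      (C := 0) fun ψ hψ hψc => by
      refine Eq.trans ?_ (hT.integral_schoutenDensity hU hg hΓ h0 (isSmoothField_const hp)
          (a := fun _ => ![w₀, w₁]) (b := fun y => ![y ^ 4 / 24, 0]) (c := fun y => ![0, ψ y])
          contDiff_const (contDiff_vec (by fun_prop) contDiff_const) (isTest_vec_right hψ hψc))
      congr 1
      funext x
      simp only [schoutenDensity]
      rw [thirdOrderOperator_const (h0 p hp) contDiff_const hψ,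
        thirdOrderOperator_const (f := fun y => y ^ 4 / 24) (h0 p hp) (by fun_prop) contDiff_const,
        thirdOrderOperator_const (f := fun _ => w₀) (h0 p hp) contDiff_const contDiff_const]
      simp [hydroDensity, thirdDensity, qVar, sVar, hydroOperator_apply, xDeriv_vec, xDeriv_const,
        Fin.sum_univ_two, hS p hp, deriv_pow_three_div, deriv_pow_four_div,
        hD, hE]
      ring
    linarith
  have h0 := key 1 0
  have h1 := key 0 1
  fin_cases i <;> simp [hD, hE] at h0 h1 ⊢ <;> linarith

/-- Compatibility at constant fields on the covectors `(x³/6, 0)` and `(x, 0)` and a test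
covector `(0, ψ)`: modulo `leading_symm`, the terms with the variation of `q` determine one
contraction of the antisymmetric part of `Γ`. -/
theorem antisymm_relation_q {p : Fin 2 → ℝ} (hp : p ∈ U) :
    Γ 0 1 0 p + p 1 / p 0 * Γ 0 1 1 p - (Γ 1 0 0 p + p 1 / p 0 * Γ 1 0 1 p) =
      -(p 1 / p 0 ^ 2) * g 0 0 p + 1 / p 0 * g 1 0 p := by
  have hK := leading_symm hU hg hΓ hS h0 hT hp 0
  have := moment_relation
    (A := -(p 1 / p 0 * Γ 0 0 0 p + (p 1 ^ 2 + 1) / p 0 ^ 2 * Γ 0 0 1 p) / 3)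
    (B := (Γ 1 0 0 p + p 1 / p 0 * Γ 1 0 1 p) -
      (-(p 1 / p 0 ^ 2) * g 0 0 p + 1 / p 0 * g 1 0 p))
    (C := -(Γ 0 1 0 p + p 1 / p 0 * Γ 0 1 1 p)) fun ψ hψ hψc => by
      refine Eq.trans ?_ (hT.integral_schoutenDensity hU hg hΓ h0 (isSmoothField_const hp)
          (a := fun y => ![y ^ 3 / 6, 0]) (b := fun y => ![y, 0]) (c := fun y => ![0, ψ y])
          (contDiff_vec (by fun_prop) contDiff_const) (contDiff_vec (by fun_prop) contDiff_const)
          (isTest_vec_right hψ hψc))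
      congr 1
      funext x
      simp only [schoutenDensity]
      rw [thirdOrderOperator_const (h0 p hp) (by fun_prop) contDiff_const,
        thirdOrderOperator_const (h0 p hp) (by fun_prop) contDiff_const,
        thirdOrderOperator_const (h0 p hp) contDiff_const hψ]
      simp [hydroDensity, thirdDensity, qVar, sVar, hydroOperator_apply, xDeriv_vec, xDeriv_const,
        Fin.sum_univ_two, hS p hp, deriv_pow_two_div, deriv_pow_three_div]
      ring
  linarith

/-- The counterpart of `antisymm_relation_q` with all components of the covectors exchanged, where
the variation of `s` enters. -/
theorem antisymm_relation_s {p : Fin 2 → ℝ} (hp : p ∈ U) :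
    p 1 / p 0 * Γ 0 1 0 p + (p 1 ^ 2 + 1) / p 0 ^ 2 * Γ 0 1 1 p -
      (p 1 / p 0 * Γ 1 0 0 p + (p 1 ^ 2 + 1) / p 0 ^ 2 * Γ 1 0 1 p) =
      -((p 1 ^ 2 + 1) / p 0 ^ 3) * g 0 0 p + p 1 / p 0 ^ 2 * g 1 0 p := by
  have hK := leading_symm hU hg hΓ hS h0 hT hp 1
  have := moment_relation
    (A := -(Γ 1 1 0 p + p 1 / p 0 * Γ 1 1 1 p) / 3)
    (B := (p 1 / p 0 * Γ 0 1 0 p + (p 1 ^ 2 + 1) / p 0 ^ 2 * Γ 0 1 1 p) +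
      (-((p 1 ^ 2 + 1) / p 0 ^ 3) * g 0 0 p + p 1 / p 0 ^ 2 * g 1 0 p))
    (C := -(p 1 / p 0 * Γ 1 0 0 p + (p 1 ^ 2 + 1) / p 0 ^ 2 * Γ 1 0 1 p)) fun ψ hψ hψc => by
      refine Eq.trans ?_ (hT.integral_schoutenDensity hU hg hΓ h0 (isSmoothField_const hp)
          (a := fun y => ![0, y ^ 3 / 6]) (b := fun y => ![0, y]) (c := fun y => ![ψ y, 0])
          (contDiff_vec contDiff_const (by fun_prop)) (contDiff_vec contDiff_const (by fun_prop))
          (isTest_vec_left hψ hψc))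
      congr 1
      funext x
      simp only [schoutenDensity]
      rw [thirdOrderOperator_const (h0 p hp) contDiff_const (by fun_prop),
        thirdOrderOperator_const (h0 p hp) contDiff_const (by fun_prop),
        thirdOrderOperator_const (h0 p hp) hψ contDiff_const]
      simp [hydroDensity, thirdDensity, qVar, sVar, hydroOperator_apply, xDeriv_vec, xDeriv_const,
        Fin.sum_univ_two, hS p hp, deriv_pow_two_div, deriv_pow_three_div]
      ring
  linarith

end
end

/-! ### Pointwise consequences along nonconstant fields -/

section
variable {U : Set (Fin 2 → ℝ)}

theorem partialDeriv_congr (hU : IsOpen U) {f h : (Fin 2 → ℝ) → ℝ} (hfh : ∀ p ∈ U, f p = h p)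
    {p : Fin 2 → ℝ} (hp : p ∈ U) (k : Fin 2) : partialDeriv k f p = partialDeriv k h p := by
  have : f =ᶠ[𝓝 p] h := by
    filter_upwards [hU.mem_nhds hp] with z hz using hfh z hz
  rw [partialDeriv, partialDeriv, this.fderiv_eq]

theorem partialDeriv_comm (hU : IsOpen U) {f : (Fin 2 → ℝ) → ℝ} (hf : ContDiffOn ℝ ∞ f U)
    {p : Fin 2 → ℝ} (hp : p ∈ U) (k l : Fin 2) :
    partialDeriv k (partialDeriv l f) p = partialDeriv l (partialDeriv k f) p := by
  have hc := hf.contDiffAt (hU.mem_nhds hp)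
  have hd : DifferentiableAt ℝ (fderiv ℝ f) p :=
    (hc.fderiv_right (m := ∞) (by simp)).differentiableAt (by simp)
  have key : ∀ k l, partialDeriv k (partialDeriv l f) p =
      fderiv ℝ (fderiv ℝ f) p (Pi.single k 1) (Pi.single l 1) := by
    intro k l
    change fderiv ℝ (fun z => fderiv ℝ f z (Pi.single l 1)) p (Pi.single k 1) = _
    rw [fderiv_clm_apply hd (differentiableAt_const _)]
    simp
  rw [key, key]
  exact hc.isSymmSndFDerivAt (by simpa using WithTop.coe_le_coe.2 (le_top : (2 : ℕ∞) ≤ ⊤)) _ _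

variable {u : TwoFun}
  {g : Fin 2 → Fin 2 → (Fin 2 → ℝ) → ℝ} {Γ : Fin 2 → Fin 2 → Fin 2 → (Fin 2 → ℝ) → ℝ}

theorem deriv_qField (hu : ContDiff ℝ ∞ u) (h0 : ∀ x, u x 0 ≠ 0) (x : ℝ) :
    deriv (qField u) x = qVar u (xDeriv u) x := by
  have hx := h0 x
  refine (((hasDerivAt_component hu 1 x).div (hasDerivAt_component hu 0 x) hx).congr_deriv
    ?_).deriv
  simp [qVar]
  field_simp
  ring

theorem deriv_sField (hu : ContDiff ℝ ∞ u) (h0 : ∀ x, u x 0 ≠ 0) (x : ℝ) :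
    deriv (sField u) x = sVar u (xDeriv u) x := by
  have hx := h0 x
  refine (((((hasDerivAt_component hu 1 x).pow 2).add_const 1).div
    (((hasDerivAt_component hu 0 x).pow 2).const_mul 2) (by simpa using hx)).congr_deriv
    ?_).deriv
  simp [sVar]
  field_simp
  ring

theorem deriv_eq_zero_of_notMem {w : ℝ → ℝ} {x : ℝ} (hx : x ∉ tsupport w) : deriv w x = 0 :=
  image_eq_zero_of_notMem_tsupport fun h => hx (tsupport_deriv_subset h)

variable (hU : IsOpen U) (hg : ∀ i j, ContDiffOn ℝ ∞ (g i j) U)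
  (hΓ : ∀ i j k, ContDiffOn ℝ ∞ (Γ i j k) U)
  (hS : ∀ p ∈ U, ∀ i j k, partialDeriv k (g i j) p = Γ i j k p + Γ j i k p)
include hU hg hS

/-- The diagonal symbols are half the gradients of `g^{ii}`, hence closed. -/
theorem partialDeriv_diag_comm {p : Fin 2 → ℝ} (hp : p ∈ U) (i k l : Fin 2) :
    partialDeriv k (Γ i i l) p = partialDeriv l (Γ i i k) p := by
  have key : ∀ k l, partialDeriv k (partialDeriv l (g i i)) p = 2 * partialDeriv k (Γ i i l) p := by
    intro k l
    rw [partialDeriv_congr hU (fun z hz => (hS z hz i i l).trans (two_mul _).symm) hp k]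
    simp only [partialDeriv]
    rw [show (fun z => 2 * Γ i i l z) = (2 : ℝ) • Γ i i l from rfl, fderiv_const_smul_field]
    simp
  have := partialDeriv_comm hU (hg i i) hp k l
  rw [key, key] at this
  linarith

variable (h0 : ∀ p ∈ U, p 0 ≠ 0)
  (hT : SchoutenBracketVanishes U (hydroOperator g Γ) thirdOrderOperator)
include h0 hT hΓ

/-- Compatibility on two constant covectors: `Γ^{12}_k` is closed. It suffices to vary the second
component of the field. -/
theorem partialDeriv_offDiag_comm {p : Fin 2 → ℝ} (hp : p ∈ U) :
    partialDeriv 0 (Γ 0 1 1) p = partialDeriv 1 (Γ 0 1 0) p := by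
  obtain ⟨w, hw, hwc, hw0, hw1, hu⟩ := exists_field hU hp (Pi.single 1 1)
  set u : TwoFun := fun x => p + w x • Pi.single 1 1 with hudef
  have hu0 : ∀ x, u x 0 ≠ 0 := fun x => h0 _ (hu.2 x)
  have hux : ∀ x, xDeriv u x = ![0, deriv w x] := fun x => by
    funext k
    rw [hudef, xDeriv_line hw]
    fin_cases k <;> simp
  have c1 := contDiff_comp_field hU (contDiffOn_partialDeriv hU (hΓ 0 1 1) 0) hu
  have c2 := contDiff_comp_field hU (contDiffOn_partialDeriv hU (hΓ 0 1 0) 1) hu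
  have cA : ContDiff ℝ ∞ fun x => deriv w x *
      (partialDeriv 0 (Γ 0 1 1) (u x) - partialDeriv 1 (Γ 0 1 0) (u x)) :=
    (contDiff_deriv hw).mul (c1.sub c2)
  have hAc : HasCompactSupport fun x => deriv w x *
      (partialDeriv 0 (Γ 0 1 1) (u x) - partialDeriv 1 (Γ 0 1 0) (u x)) := hwc.deriv.mul_right
  have hA := eq_deriv_of_forall_integral (B := fun _ => 0) cA contDiff_const
    (by simp only [zero_sub]; exact hAc.deriv.neg) fun ψ hψ hψc => by
      refine Eq.trans ?_ (hT.integral_schoutenDensity hU hg hΓ h0 hu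
        (a := fun _ => ![1, 0]) (b := fun _ => ![0, 1]) (c := fun y => ![ψ y, 0])
        contDiff_const contDiff_const (isTest_vec_left hψ hψc))
      congr 1
      funext x
      have e1 := thirdOrderOperator_apply hu.1 hu0 (contDiff_vec hψ (contDiff_const (c := 0))) x
      have e2 := thirdOrderOperator_apply hu.1 hu0 (contDiff_const (c := ![1, 0])) x
      have e3 := thirdOrderOperator_apply hu.1 hu0 (contDiff_const (c := ![0, 1])) x
      simp [schoutenDensity, hydroDensity, thirdDensity, qVar, sVar, hydroOperator_apply,
        xDeriv_vec, Fin.sum_univ_two, hS _ (hu.2 x), hux, e1, e2, e3]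
  -- `A` has zero derivative and compact support, and `u' ≠ 0` at `x = 0`.
  have := eq_zero_of_deriv_eq_zero_of_hasCompactSupport cA hAc (fun x => (hA x).symm) 0
  have hup : u 0 = p := by simp [hudef, hw0]
  rw [hup] at this
  exact sub_eq_zero.1 ((mul_eq_zero.1 this).resolve_left hw1)

/-- Compatibility on covectors whose second components vanish, the first of them constant and the
second linear. -/
theorem hessian_relation_first {p : Fin 2 → ℝ} (hp : p ∈ U) (m : Fin 2) :
    partialDeriv m (Γ 0 0 0) p + p 1 / p 0 * partialDeriv m (Γ 0 0 1) p = 0 := by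
  obtain ⟨w, hw, hwc, hw0, hw1, hu⟩ := exists_field hU hp (Pi.single m 1)
  set u : TwoFun := fun x => p + w x • Pi.single m 1 with hudef
  have hu0 : ∀ x, u x 0 ≠ 0 := fun x => h0 _ (hu.2 x)
  have hux : ∀ x k, xDeriv u x k = deriv w x * (Pi.single m 1 : Fin 2 → ℝ) k := fun x k =>
    xDeriv_line hw x k
  have cΓ := fun k => contDiff_comp_field hU (hΓ 0 0 k) hu
  have dΓ := fun k => hasDerivAt_comp_field hU (hΓ 0 0 k) hu
  have cq := contDiff_qField hu.1 hu0
  have dq := contDiff_hasDerivAt cq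
  have dA : ∀ x, deriv (fun x => Γ 0 0 0 (u x) + qField u x * Γ 0 0 1 (u x)) x = _ := fun x =>
    ((dΓ 0 x).add ((dq x).mul (dΓ 1 x))).deriv
  have hA := eq_deriv_of_forall_integral
    (A := fun x => Γ 0 0 0 (u x) + qField u x * Γ 0 0 1 (u x))
    (B := fun x => deriv (qField u) x * Γ 0 0 1 (u x))
    ((cΓ 0).add (cq.mul (cΓ 1))) ((contDiff_deriv cq).mul (cΓ 1))
    (HasCompactSupport.intro hwc fun x hx => by
      simp [dA, hux, deriv_eq_zero_of_notMem hx]) (fun ψ hψ hψc => by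
      refine Eq.trans ?_ (hT.integral_schoutenDensity hU hg hΓ h0 hu
        (a := fun _ => ![1, 0]) (b := fun y => ![y, 0]) (c := fun y => ![ψ y, 0])
        contDiff_const (contDiff_vec contDiff_id contDiff_const) (isTest_vec_left hψ hψc))
      congr 1
      funext x
      have e1 := thirdOrderOperator_apply hu.1 hu0 (contDiff_vec hψ (contDiff_const (c := 0))) x
      have e2 := thirdOrderOperator_apply hu.1 hu0 (contDiff_const (c := ![1, 0])) x
      have e3 := thirdOrderOperator_apply hu.1 hu0
        (contDiff_vec contDiff_id (contDiff_const (c := 0))) x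
      simp only [id_eq] at e3
      have e4 := partialDeriv_diag_comm hU hg hS (hu.2 x) 0 0 1
      simp [schoutenDensity, hydroDensity, thirdDensity, qVar, sVar, hydroOperator_apply,
        xDeriv_vec, Fin.sum_univ_two, hS _ (hu.2 x), e1, e2, e3, e4]
      ring) 0
  have hup : u 0 = p := by simp [hudef, hw0]
  rw [dA] at hA
  simp only [hux, Fin.sum_univ_two, hup, qField] at hA
  have : deriv w 0 * (partialDeriv m (Γ 0 0 0) p + p 1 / p 0 * partialDeriv m (Γ 0 0 1) p) = 0 := by
    fin_cases m <;> simp [-mul_eq_zero] at hA ⊢ <;> linear_combination (-1) * hA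
  exact (mul_eq_zero.1 this).resolve_left hw1

/-- Compatibility on covectors whose first components vanish, the first of them constant and the
second linear. -/
theorem hessian_relation_second {p : Fin 2 → ℝ} (hp : p ∈ U) (m : Fin 2) :
    p 1 / p 0 * partialDeriv m (Γ 1 1 0) p +
        (p 1 ^ 2 + 1) / p 0 ^ 2 * partialDeriv m (Γ 1 1 1) p =
      (qVar (fun _ => p) (fun _ => Pi.single m 1) 0 * Γ 1 1 0 p +
        sVar (fun _ => p) (fun _ => Pi.single m 1) 0 * Γ 1 1 1 p) -
      sVar (fun _ => p) (fun _ => ![Γ 0 1 m p, Γ 1 1 m p]) 0 := by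
  obtain ⟨w, hw, hwc, hw0, hw1, hu⟩ := exists_field hU hp (Pi.single m 1)
  set u : TwoFun := fun x => p + w x • Pi.single m 1 with hudef
  have hu0 : ∀ x, u x 0 ≠ 0 := fun x => h0 _ (hu.2 x)
  have hux : ∀ x k, xDeriv u x k = deriv w x * (Pi.single m 1 : Fin 2 → ℝ) k := fun x k =>
    xDeriv_line hw x k
  have cΓ := fun k => contDiff_comp_field hU (hΓ 1 1 k) hu
  have dΓ := fun k => hasDerivAt_comp_field hU (hΓ 1 1 k) hu
  have cq := contDiff_qField hu.1 hu0
  have cs := contDiff_sField hu.1 hu0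
  have dq := contDiff_hasDerivAt cq
  have ds := contDiff_hasDerivAt cs
  have cP := contDiff_hydroOperator hU hg hΓ hu (contDiff_const (c := ![0, 1]))
  have cS := contDiff_sVar hu.1 cP hu0
  have hP : ∀ x, hydroOperator g Γ u (fun _ => ![0, 1]) x =
      fun i => ∑ k, Γ i 1 k (u x) * xDeriv u x k := fun x => by
    funext i
    simp [hydroOperator_apply, xDeriv_const]
  have dA : ∀ x, deriv (fun x => qField u x * Γ 1 1 0 (u x) + 2 * sField u x * Γ 1 1 1 (u x)) x =
      _ := fun x => (((dq x).mul (dΓ 0 x)).add (((ds x).const_mul 2).mul (dΓ 1 x))).deriv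
  have hA := eq_deriv_of_forall_integral
    (A := fun x => qField u x * Γ 1 1 0 (u x) + 2 * sField u x * Γ 1 1 1 (u x))
    (B := fun x => 2 * deriv (qField u) x * Γ 1 1 0 (u x) +
      3 * deriv (sField u) x * Γ 1 1 1 (u x) -
      sVar u (hydroOperator g Γ u fun _ => ![0, 1]) x)
    ((cq.mul (cΓ 0)).add ((contDiff_const.mul cs).mul (cΓ 1)))
    ((((contDiff_const.mul (contDiff_deriv cq)).mul (cΓ 0)).add
      ((contDiff_const.mul (contDiff_deriv cs)).mul (cΓ 1))).sub cS)
    (HasCompactSupport.intro hwc fun x hx => by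
      simp [dA, hux, deriv_eq_zero_of_notMem hx, deriv_qField hu.1 hu0, deriv_sField hu.1 hu0,
        qVar, sVar, hP]) (fun ψ hψ hψc => by
      refine Eq.trans ?_ (hT.integral_schoutenDensity hU hg hΓ h0 hu
        (a := fun _ => ![0, 1]) (b := fun y => ![0, y]) (c := fun y => ![0, ψ y])
        contDiff_const (contDiff_vec contDiff_const contDiff_id) (isTest_vec_right hψ hψc))
      congr 1
      funext x
      have e1 := thirdOrderOperator_apply hu.1 hu0 (contDiff_vec (contDiff_const (c := 0)) hψ) x
      have e2 := thirdOrderOperator_apply hu.1 hu0 (contDiff_const (c := ![0, 1])) x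
      have e3 := thirdOrderOperator_apply hu.1 hu0
        (contDiff_vec (contDiff_const (c := 0)) contDiff_id) x
      simp only [id_eq] at e3
      have e4 := partialDeriv_diag_comm hU hg hS (hu.2 x) 1 0 1
      simp [schoutenDensity, hydroDensity, thirdDensity, xDeriv_vec,
        Fin.sum_univ_two, hS _ (hu.2 x), e1, e2, e3, e4]
      ring) 0
  have hup : u 0 = p := by simp [hudef, hw0]
  rw [dA] at hA
  simp only [hux, Fin.sum_univ_two, hup, qField, sField, deriv_qField hu.1 hu0,
    deriv_sField hu.1 hu0, qVar, sVar, hP] at hA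
  have hp0 := h0 p hp
  have hs2 : 2 * ((p 1 ^ 2 + 1) / (2 * p 0 ^ 2)) = (p 1 ^ 2 + 1) / p 0 ^ 2 := by field_simp
  refine sub_eq_zero.1 ((mul_eq_zero.1 (?_ : deriv w 0 * _ = 0)).resolve_left hw1)
  simp only [hs2] at hA
  fin_cases m <;> simp [qVar, sVar, -mul_eq_zero] at hA ⊢ <;> linear_combination (-1) * hA

end

/-! ### The overdetermined system for the metric -/

/-- `f` is differentiable at `p` with partial derivatives `d₀` and `d₁`. -/
def HasPartials (f : (Fin 2 → ℝ) → ℝ) (p : Fin 2 → ℝ) (d₀ d₁ : ℝ) : Prop :=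
  HasFDerivAt f (d₀ • (ContinuousLinearMap.proj 0 : (Fin 2 → ℝ) →L[ℝ] ℝ) +
    d₁ • (ContinuousLinearMap.proj 1 : (Fin 2 → ℝ) →L[ℝ] ℝ)) p

namespace HasPartials
variable {f h : (Fin 2 → ℝ) → ℝ} {p : Fin 2 → ℝ} {a b c d : ℝ}

theorem partialDeriv_zero (hf : HasPartials f p a b) : partialDeriv 0 f p = a := by
  rw [partialDeriv, HasFDerivAt.fderiv hf]
  simp

theorem partialDeriv_one (hf : HasPartials f p a b) : partialDeriv 1 f p = b := by
  rw [partialDeriv, HasFDerivAt.fderiv hf]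
  simp

theorem congr (hf : HasPartials f p a b) (ha : a = c) (hb : b = d) : HasPartials f p c d := by
  subst ha hb
  exact hf

theorem const (r : ℝ) : HasPartials (fun _ => r) p 0 0 := by
  simpa [HasPartials] using hasFDerivAt_const r p

theorem fst : HasPartials (fun z => z 0) p 1 0 := by
  simpa [HasPartials] using hasFDerivAt_apply (𝕜 := ℝ) (0 : Fin 2) p

theorem snd : HasPartials (fun z => z 1) p 0 1 := by
  simpa [HasPartials] using hasFDerivAt_apply (𝕜 := ℝ) (1 : Fin 2) p

theorem add (hf : HasPartials f p a b) (hh : HasPartials h p c d) :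
    HasPartials (fun z => f z + h z) p (a + c) (b + d) := by
  refine (HasFDerivAt.add hf hh).congr_fderiv ?_
  ext v
  simp
  ring

theorem sub (hf : HasPartials f p a b) (hh : HasPartials h p c d) :
    HasPartials (fun z => f z - h z) p (a - c) (b - d) := by
  refine (HasFDerivAt.sub hf hh).congr_fderiv ?_
  ext v
  simp
  ring

theorem neg (hf : HasPartials f p a b) : HasPartials (fun z => -f z) p (-a) (-b) := by
  simpa only [zero_sub] using (const 0).sub hf

theorem mul (hf : HasPartials f p a b) (hh : HasPartials h p c d) :
    HasPartials (fun z => f z * h z) p (a * h p + f p * c) (b * h p + f p * d) := by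
  refine (HasFDerivAt.mul hf hh).congr_fderiv ?_
  ext v
  simp
  ring

theorem inv (hf : HasPartials f p a b) (h0 : f p ≠ 0) :
    HasPartials (fun z => (f z)⁻¹) p (-a / f p ^ 2) (-b / f p ^ 2) := by
  refine ((hasDerivAt_inv h0).comp_hasFDerivAt p hf).congr_fderiv ?_
  ext v
  simp
  ring

theorem div (hf : HasPartials f p a b) (hh : HasPartials h p c d) (h0 : h p ≠ 0) :
    HasPartials (fun z => f z / h z) p ((a * h p - f p * c) / h p ^ 2)
      ((b * h p - f p * d) / h p ^ 2) := by
  simp only [div_eq_mul_inv]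
  refine (hf.mul (hh.inv h0)).congr ?_ ?_ <;> field_simp <;> ring

theorem pow_two (hf : HasPartials f p a b) :
    HasPartials (fun z => f z ^ 2) p (2 * f p * a) (2 * f p * b) := by
  simp only [sq]
  exact (hf.mul hf).congr (by ring) (by ring)

theorem of_contDiffOn {U : Set (Fin 2 → ℝ)} (hU : IsOpen U) (hf : ContDiffOn ℝ ∞ f U)
    (hp : p ∈ U) : HasPartials f p (partialDeriv 0 f p) (partialDeriv 1 f p) := by
  refine (differentiableAt_of_contDiffOn hU hf hp).hasFDerivAt.congr_fderiv ?_
  ext v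
  have : v = v 0 • (Pi.single 0 1 : Fin 2 → ℝ) + v 1 • (Pi.single 1 1 : Fin 2 → ℝ) := by
    funext i
    fin_cases i <;> simp
  conv_lhs => rw [this]
  simp [partialDeriv, mul_comm]

/-- Functions that agree on an open set have the same partial derivatives there. -/
theorem unique {U : Set (Fin 2 → ℝ)} (hU : IsOpen U) (hfh : ∀ z ∈ U, f z = h z) (hp : p ∈ U)
    (hf : HasPartials f p a b) (hh : HasPartials h p c d) : a = c ∧ b = d := by
  have h0 := partialDeriv_congr hU hfh hp 0
  have h1 := partialDeriv_congr hU hfh hp 1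
  rw [hf.partialDeriv_zero, hh.partialDeriv_zero] at h0
  rw [hf.partialDeriv_one, hh.partialDeriv_one] at h1
  exact ⟨h0, h1⟩

theorem exists_const {U : Set (Fin 2 → ℝ)} (hU : IsOpen U) (hUc : IsConnected U)
    (hf : ∀ z ∈ U, HasPartials f z 0 0) : ∃ r, ∀ z ∈ U, f z = r := by
  have hf' : ∀ z ∈ U, HasFDerivAt f 0 z := fun z hz => by simpa [HasPartials] using hf z hz
  exact hU.exists_is_const_of_fderiv_eq_zero hUc.isPreconnected
    (fun z hz => (hf' z hz).differentiableAt.differentiableWithinAt)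
    fun z hz => (hf' z hz).fderiv

end HasPartials

section
variable {U : Set (Fin 2 → ℝ)} {a b d : (Fin 2 → ℝ) → ℝ}

/-- The part of the system that involves `a = g¹¹` and `b = g¹²` only: `a` is affine, and the two
first-order equations integrate to `b`. -/
theorem solve_first_row (hU : IsOpen U) (hUc : IsConnected U) (h0 : ∀ p ∈ U, p 0 ≠ 0)
    (ha : ContDiffOn ℝ ∞ a U) (hb : ContDiffOn ℝ ∞ b U)
    (hby : ∀ p ∈ U, partialDeriv 1 b p = a p / p 0 - partialDeriv 0 a p)
    (hbx : ∀ p ∈ U, partialDeriv 0 b p = b p / p 0 + 2 * (p 1 / p 0) * partialDeriv 0 a p +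
      (p 1 ^ 2 + 1) / p 0 ^ 2 * partialDeriv 1 a p - 2 * (p 1 / p 0) * (a p / p 0))
    (haa : ∀ p ∈ U, ∀ m, partialDeriv m (partialDeriv 0 a) p +
      p 1 / p 0 * partialDeriv m (partialDeriv 1 a) p = 0) :
    ∃ c₁ c₂ c₃ c₄ : ℝ, ∀ p ∈ U, a p = c₁ * p 0 + c₂ * p 1 + c₃ ∧
      b p = c₄ * p 0 - c₂ / (2 * p 0) + c₃ * p 1 / p 0 + c₂ * (p 1) ^ 2 / (2 * p 0) := by
  have ha0 := contDiffOn_partialDeriv hU ha 0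
  have ha1 := contDiffOn_partialDeriv hU ha 1
  have hb0 := contDiffOn_partialDeriv hU hb 0
  have hb1 := contDiffOn_partialDeriv hU hb 1
  have hess : ∀ p ∈ U, HasPartials (partialDeriv 0 a) p 0 0 ∧
      HasPartials (partialDeriv 1 a) p 0 0 := by
    intro p hp
    have hp0 := h0 p hp
    have Pa := HasPartials.of_contDiffOn hU ha hp
    have Pb := HasPartials.of_contDiffOn hU hb hp
    have Pa0 := HasPartials.of_contDiffOn hU ha0 hp
    have Pa1 := HasPartials.of_contDiffOn hU ha1 hp
    have e1 := (HasPartials.unique hU hby hp (HasPartials.of_contDiffOn hU hb1 hp)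
      ((Pa.div .fst hp0).sub Pa0)).1
    have hq := HasPartials.div .snd .fst hp0
    have e2 := (HasPartials.unique hU hbx hp (HasPartials.of_contDiffOn hU hb0 hp)
      ((((Pb.div .fst hp0).add (((HasPartials.const 2).mul hq).mul Pa0)).add
        (((HasPartials.snd.pow_two.add (.const 1)).div HasPartials.fst.pow_two
          (pow_ne_zero 2 hp0)).mul Pa1)).sub
        (((HasPartials.const 2).mul hq).mul (Pa.div .fst hp0)))).2
    rw [partialDeriv_comm hU hb hp 1 0, e1, hby p hp] at e2
    have m0 := haa p hp 0
    have m1 := haa p hp 1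
    rw [partialDeriv_comm hU ha hp 1 0] at m1 e2
    have k2 : partialDeriv 0 (partialDeriv 1 a) p =
        -(p 1 / p 0) * partialDeriv 1 (partialDeriv 1 a) p := by linear_combination m1
    have k1 : partialDeriv 0 (partialDeriv 0 a) p =
        (p 1 / p 0) ^ 2 * partialDeriv 1 (partialDeriv 1 a) p := by
      linear_combination m0 - p 1 / p 0 * k2
    rw [k2, k1] at e2
    have k3 : partialDeriv 1 (partialDeriv 1 a) p = 0 := by
      rw [← sub_eq_zero] at e2
      refine (mul_eq_zero.1 (?_ : (p 0 ^ 2)⁻¹ * _ = 0)).resolve_left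
        (inv_ne_zero (pow_ne_zero 2 hp0))
      rw [← neg_eq_zero, ← e2]
      field_simp
      ring
    rw [k3, mul_zero] at k1 k2
    have k2' := partialDeriv_comm hU ha hp 1 0
    rw [k2] at k2'
    exact ⟨Pa0.congr k1 k2', Pa1.congr k2 k3⟩
  obtain ⟨c₁, hc₁⟩ := HasPartials.exists_const hU hUc fun z hz => (hess z hz).1
  obtain ⟨c₂, hc₂⟩ := HasPartials.exists_const hU hUc fun z hz => (hess z hz).2
  obtain ⟨c₃, hc₃⟩ := HasPartials.exists_const (f := fun z => a z - (c₁ * z 0 + c₂ * z 1)) hU hUc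
    fun z hz => ((HasPartials.of_contDiffOn hU ha hz).sub
      (((HasPartials.const c₁).mul .fst).add ((HasPartials.const c₂).mul .snd))).congr
      (by simp [hc₁ z hz]) (by simp [hc₂ z hz])
  have ha' : ∀ z ∈ U, a z = c₁ * z 0 + c₂ * z 1 + c₃ := fun z hz => by
    linear_combination hc₃ z hz
  obtain ⟨c₄, hc₄⟩ := HasPartials.exists_const
    (f := fun z => b z / z 0 + (c₂ * (1 - z 1 ^ 2) - 2 * c₃ * z 1) / (2 * z 0 ^ 2)) hU hUc
    fun z hz => by
      have hz0 := h0 z hz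
      refine (((HasPartials.of_contDiffOn hU hb hz).div .fst hz0).add
        ((((HasPartials.const c₂).mul ((HasPartials.const 1).sub HasPartials.snd.pow_two)).sub
          ((HasPartials.const (2 * c₃)).mul .snd)).div
          ((HasPartials.const 2).mul HasPartials.fst.pow_two) (by simpa using hz0))).congr ?_ ?_
      · rw [hbx z hz, hc₁ z hz, hc₂ z hz, ha' z hz]
        field_simp
        ring
      · rw [hby z hz, hc₁ z hz, ha' z hz]
        field_simp
        ring
  refine ⟨c₁, c₂, c₃, c₄, fun z hz => ⟨ha' z hz, ?_⟩⟩
  have hz0 := h0 z hz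
  have := hc₄ z hz
  rw [← this]
  field_simp
  ring

/-- The part of the system that involves `d = g²²`: the first-order equation gives `∂₁ d` in terms
of `∂₂ d`, and the second-order one the Hessian. -/
theorem solve_second_row (hU : IsOpen U) (hUc : IsConnected U) (h0 : ∀ p ∈ U, p 0 ≠ 0)
    (hd : ContDiffOn ℝ ∞ d U) {c₁ c₄ : ℝ}
    (hdx : ∀ p ∈ U, partialDeriv 0 d p = 2 * c₄ * (p 1 / p 0) - c₁ * ((p 1 ^ 2 + 1) / p 0 ^ 2) -
      p 1 / p 0 * partialDeriv 1 d p)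
    (hdd₀ : ∀ p ∈ U, p 1 / p 0 * partialDeriv 0 (partialDeriv 0 d) p +
        (p 1 ^ 2 + 1) / p 0 ^ 2 * partialDeriv 0 (partialDeriv 1 d) p =
      -(p 1 / p 0 ^ 2) * partialDeriv 0 d p - (p 1 ^ 2 + 1) / p 0 ^ 3 * partialDeriv 1 d p +
      2 * c₄ * ((p 1 ^ 2 + 1) / p 0 ^ 3) - p 1 / p 0 ^ 2 * partialDeriv 0 d p)
    (hdd₁ : ∀ p ∈ U, p 1 / p 0 * partialDeriv 1 (partialDeriv 0 d) p +
        (p 1 ^ 2 + 1) / p 0 ^ 2 * partialDeriv 1 (partialDeriv 1 d) p =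
      1 / p 0 * partialDeriv 0 d p + p 1 / p 0 ^ 2 * partialDeriv 1 d p -
      c₁ * ((p 1 ^ 2 + 1) / p 0 ^ 3) - p 1 / p 0 ^ 2 * partialDeriv 1 d p) :
    ∃ c₅ c₆ : ℝ, ∀ p ∈ U,
      d p = 2 * c₄ * p 1 + c₁ / p 0 + c₅ * p 1 / p 0 - c₁ * (p 1) ^ 2 / p 0 + c₆ := by
  have hd0 := contDiffOn_partialDeriv hU hd 0
  have hd1 := contDiffOn_partialDeriv hU hd 1
  obtain ⟨c₅, hc₅⟩ := HasPartials.exists_const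
    (f := fun z => z 0 * partialDeriv 1 d z - 2 * c₄ * z 0 + 2 * c₁ * z 1) hU hUc
    fun p hp => by
      have hp0 := h0 p hp
      have Pd1 := HasPartials.of_contDiffOn hU hd1 hp
      have hq := HasPartials.div .snd .fst hp0
      obtain ⟨e0, e1⟩ := HasPartials.unique hU hdx hp (HasPartials.of_contDiffOn hU hd0 hp)
        ((((HasPartials.const (2 * c₄)).mul hq).sub ((HasPartials.const c₁).mul
          ((HasPartials.snd.pow_two.add (.const 1)).div HasPartials.fst.pow_two
            (pow_ne_zero 2 hp0)))).sub (hq.mul Pd1))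
      have m0 := hdd₀ p hp
      have m1 := hdd₁ p hp
      rw [e0, hdx p hp, ← sub_eq_zero] at m0
      rw [e1, hdx p hp, ← sub_eq_zero] at m1
      refine (((HasPartials.fst.mul Pd1).sub ((HasPartials.const (2 * c₄)).mul .fst)).add
        ((HasPartials.const (2 * c₁)).mul .snd)).congr ?_ ?_
      · refine Eq.trans ?_ ((congrArg (p 0 ^ 3 * ·) m0).trans (mul_zero _))
        field_simp
        ring
      · refine Eq.trans ?_ ((congrArg (p 0 ^ 3 * ·) m1).trans (mul_zero _))
        field_simp
        ring
  have hdy : ∀ p ∈ U, partialDeriv 1 d p = 2 * c₄ + (c₅ - 2 * c₁ * p 1) / p 0 := fun p hp => by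
    have hp0 := h0 p hp
    rw [← hc₅ p hp]
    field_simp
    ring
  obtain ⟨c₆, hc₆⟩ := HasPartials.exists_const
    (f := fun z => d z - (2 * c₄ * z 1 + (c₁ + c₅ * z 1 - c₁ * z 1 ^ 2) / z 0)) hU hUc
    fun p hp => by
      have hp0 := h0 p hp
      refine ((HasPartials.of_contDiffOn hU hd hp).sub (((HasPartials.const (2 * c₄)).mul .snd).add
        ((((HasPartials.const c₁).add ((HasPartials.const c₅).mul .snd)).sub
          ((HasPartials.const c₁).mul HasPartials.snd.pow_two)).div .fst hp0))).congr ?_ ?_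
      · rw [hdx p hp, hdy p hp]
        field_simp
        ring
      · rw [hdy p hp]
        field_simp
        ring
  refine ⟨c₅, c₆, fun p hp => ?_⟩
  rw [← hc₆ p hp]
  ring

end

/-! ### The symbols of the rational metrics -/

/-- The contravariant symbols `Γ^{ij}_k` that belong to the rational metric with constants
`c₁, …, c₆` (they do not involve `c₆`). They are defined without reference to the inverse metric,
so that degenerate metrics are included. -/
noncomputable def rationalGamma (c₁ c₂ c₃ c₄ c₅ : ℝ) (i j k : Fin 2) (p : Fin 2 → ℝ) : ℝ :=
  (![![![c₁ / 2, c₂ / 2], ![c₄, -c₁ / 2]],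
    ![![-(c₂ * (p 1 ^ 2 - 1) / 2 + c₃ * p 1) / p 0 ^ 2, c₁ / 2 + (c₂ * p 1 + c₃) / p 0],
      ![(c₁ * (p 1 ^ 2 - 1) - c₅ * p 1) / (2 * p 0 ^ 2), c₄ + (c₅ / 2 - c₁ * p 1) / p 0]]] :
    Fin 2 → Fin 2 → Fin 2 → ℝ) i j k

section
variable {U : Set (Fin 2 → ℝ)}
  {g : Fin 2 → Fin 2 → (Fin 2 → ℝ) → ℝ} {Γ : Fin 2 → Fin 2 → Fin 2 → (Fin 2 → ℝ) → ℝ}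
  {c₁ c₂ c₃ c₄ c₅ c₆ : ℝ}

theorem HasRationalForm.symm (h : HasRationalForm U g c₁ c₂ c₃ c₄ c₅ c₆) {p : Fin 2 → ℝ}
    (hp : p ∈ U) (i j : Fin 2) : g i j p = g j i p := by
  have := (h p hp).2.2.1
  fin_cases i <;> fin_cases j <;> simp [this]

/-- The partial derivatives of a rational metric are the symmetrized symbols. -/
theorem HasRationalForm.partialDeriv_eq (hU : IsOpen U) (h0 : ∀ p ∈ U, p 0 ≠ 0)
    (h : HasRationalForm U g c₁ c₂ c₃ c₄ c₅ c₆) {p : Fin 2 → ℝ} (hp : p ∈ U) (i j k : Fin 2) :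
    partialDeriv k (g i j) p =
      rationalGamma c₁ c₂ c₃ c₄ c₅ i j k p + rationalGamma c₁ c₂ c₃ c₄ c₅ j i k p := by
  have hp0 := h0 p hp
  have f00 : HasPartials (fun z => c₁ * z 0 + c₂ * z 1 + c₃) p c₁ c₂ :=
    ((((HasPartials.const c₁).mul .fst).add ((HasPartials.const c₂).mul .snd)).add
      (.const c₃)).congr (by ring) (by ring)
  have f01 : HasPartials (fun z => c₄ * z 0 - c₂ / (2 * z 0) + c₃ * z 1 / z 0 +
      c₂ * z 1 ^ 2 / (2 * z 0)) p
      (c₄ - (c₂ * (p 1 ^ 2 - 1) / 2 + c₃ * p 1) / p 0 ^ 2) ((c₂ * p 1 + c₃) / p 0) := by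
    have h2 : HasPartials (fun z => 2 * z 0) p _ _ := (HasPartials.const 2).mul .fst
    refine (((((HasPartials.const c₄).mul .fst).sub ((HasPartials.const c₂).div h2
      (by simpa using hp0))).add (((HasPartials.const c₃).mul .snd).div .fst hp0)).add
      (((HasPartials.const c₂).mul HasPartials.snd.pow_two).div h2 (by simpa using hp0))).congr
      ?_ ?_ <;> field_simp <;> ring
  have f11 : HasPartials (fun z => 2 * c₄ * z 1 + c₁ / z 0 + c₅ * z 1 / z 0 -
      c₁ * z 1 ^ 2 / z 0 + c₆) p ((c₁ * (p 1 ^ 2 - 1) - c₅ * p 1) / p 0 ^ 2)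
      (2 * (c₄ + (c₅ / 2 - c₁ * p 1) / p 0)) := by
    refine ((((((HasPartials.const (2 * c₄)).mul .snd).add ((HasPartials.const c₁).div .fst
      hp0)).add (((HasPartials.const c₅).mul .snd).div .fst hp0)).sub
      (((HasPartials.const c₁).mul HasPartials.snd.pow_two).div .fst hp0)).add
      (.const c₆)).congr ?_ ?_ <;> field_simp <;> ring
  have e00 := fun k => partialDeriv_congr hU (fun z hz => (h z hz).1) hp k
  have e01 := fun k => partialDeriv_congr hU (fun z hz => (h z hz).2.1) hp k
  have e10 := fun k => partialDeriv_congr hU (fun z hz => (h z hz).2.2.1) hp k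
  have e11 := fun k => partialDeriv_congr hU (fun z hz => (h z hz).2.2.2) hp k
  fin_cases i <;> fin_cases j <;> fin_cases k <;>
    simp only [Fin.zero_eta, Fin.mk_one, e00, e10, e01, e11, f00.partialDeriv_zero,
      f00.partialDeriv_one, f01.partialDeriv_zero, f01.partialDeriv_one, f11.partialDeriv_zero,
      f11.partialDeriv_one, rationalGamma, Matrix.cons_val_zero, Matrix.cons_val_one] <;>
    field_simp <;> ring

/-- For a rational metric, the torsion condition on its symbols amounts to the quadratic
conditions. -/
theorem HasRationalForm.torsion_zero (h0 : ∀ p ∈ U, p 0 ≠ 0)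
    (h : HasRationalForm U g c₁ c₂ c₃ c₄ c₅ c₆) {p : Fin 2 → ℝ} (hp : p ∈ U) :
    2 * p 0 * (rationalGamma c₁ c₂ c₃ c₄ c₅ 0 0 0 p * g 0 1 p +
        rationalGamma c₁ c₂ c₃ c₄ c₅ 0 0 1 p * g 1 1 p -
      (rationalGamma c₁ c₂ c₃ c₄ c₅ 1 0 0 p * g 0 0 p +
        rationalGamma c₁ c₂ c₃ c₄ c₅ 1 0 1 p * g 1 0 p)) =
      (c₂ * c₆ - 2 * c₃ * c₄) * p 0 + (c₂ * c₅ + 2 * c₁ * c₃) * p 1 := by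
  have hp0 := h0 p hp
  obtain ⟨h00, h01, h10, h11⟩ := h p hp
  simp only [h10, h00, h01, h11, rationalGamma, Matrix.cons_val_zero, Matrix.cons_val_one]
  field_simp
  ring

theorem HasRationalForm.torsion_one (h0 : ∀ p ∈ U, p 0 ≠ 0)
    (h : HasRationalForm U g c₁ c₂ c₃ c₄ c₅ c₆) {p : Fin 2 → ℝ} (hp : p ∈ U) :
    2 * p 0 ^ 2 * (rationalGamma c₁ c₂ c₃ c₄ c₅ 0 1 0 p * g 0 1 p +
        rationalGamma c₁ c₂ c₃ c₄ c₅ 0 1 1 p * g 1 1 p -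
      (rationalGamma c₁ c₂ c₃ c₄ c₅ 1 1 0 p * g 0 0 p +
        rationalGamma c₁ c₂ c₃ c₄ c₅ 1 1 1 p * g 1 0 p)) =
      (c₂ * c₅ + 2 * c₁ * c₃) * (1 + p 1 ^ 2) / 2 - (c₁ * c₆ + c₄ * c₅) * p 0 ^ 2 := by
  have hp0 := h0 p hp
  obtain ⟨h00, h01, h10, h11⟩ := h p hp
  simp only [h10, h00, h01, h11, rationalGamma, Matrix.cons_val_zero, Matrix.cons_val_one]
  field_simp
  ring

theorem HasRationalForm.quadraticConditions (hU : IsOpen U) (hUc : IsConnected U)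
    (h0 : ∀ p ∈ U, p 0 ≠ 0) (h : HasRationalForm U g c₁ c₂ c₃ c₄ c₅ c₆)
    (hΓ : ∀ p ∈ U, ∀ i j k, Γ i j k p = rationalGamma c₁ c₂ c₃ c₄ c₅ i j k p)
    (hH : ∀ p ∈ U, ∀ i, Γ 0 i 0 p * g 0 1 p + Γ 0 i 1 p * g 1 1 p =
      Γ 1 i 0 p * g 0 0 p + Γ 1 i 1 p * g 1 0 p) :
    QuadraticConditions c₁ c₂ c₃ c₄ c₅ c₆ := by
  have e0 : ∀ p ∈ U, (c₂ * c₆ - 2 * c₃ * c₄) * p 0 + (c₂ * c₅ + 2 * c₁ * c₃) * p 1 = 0 := by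
    intro p hp
    rw [← h.torsion_zero h0 hp]
    simp only [← hΓ p hp, hH p hp, sub_self, mul_zero]
  have e1 : ∀ p ∈ U, (c₂ * c₅ + 2 * c₁ * c₃) * (1 + p 1 ^ 2) / 2 -
      (c₁ * c₆ + c₄ * c₅) * p 0 ^ 2 = 0 := by
    intro p hp
    rw [← h.torsion_one h0 hp]
    simp only [← hΓ p hp, hH p hp, sub_self, mul_zero]
  obtain ⟨p, hp⟩ := hUc.nonempty
  -- A linear form that vanishes on an open set has vanishing coefficients.
  obtain ⟨k0, k1⟩ := HasPartials.unique hU e0 hp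
    (((HasPartials.const _).mul .fst).add ((HasPartials.const _).mul .snd)) (.const 0)
  simp only [zero_mul, mul_one, mul_zero, zero_add, add_zero] at k0 k1
  have k2 := e1 p hp
  rw [k1] at k2
  refine ⟨k1, k0, (mul_eq_zero.1 (?_ : _ * p 0 ^ 2 = 0)).resolve_right (pow_ne_zero 2 (h0 p hp))⟩
  linarith

/-- The symbols are recovered from the metric by the two algebraic relations for their
antisymmetric part. -/
theorem eq_rationalGamma (hU : IsOpen U) (h0 : ∀ p ∈ U, p 0 ≠ 0)
    (h : HasRationalForm U g c₁ c₂ c₃ c₄ c₅ c₆)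
    (hS : ∀ p ∈ U, ∀ i j k, partialDeriv k (g i j) p = Γ i j k p + Γ j i k p)
    {p : Fin 2 → ℝ} (hp : p ∈ U) (hA₀ : Γ 0 1 0 p - Γ 1 0 0 p = g 0 1 p / p 0)
    (hA₁ : Γ 0 1 1 p - Γ 1 0 1 p = -(g 0 0 p / p 0)) (i j k : Fin 2) :
    Γ i j k p = rationalGamma c₁ c₂ c₃ c₄ c₅ i j k p := by
  have hp0 := h0 p hp
  have key := fun i j k => (hS p hp i j k).symm.trans (h.partialDeriv_eq hU h0 hp i j k)
  obtain ⟨h00, h01, h10, h11⟩ := h p hp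
  have r0 : rationalGamma c₁ c₂ c₃ c₄ c₅ 0 1 0 p - rationalGamma c₁ c₂ c₃ c₄ c₅ 1 0 0 p =
      g 0 1 p / p 0 := by
    rw [h01]
    simp only [rationalGamma, Matrix.cons_val_zero, Matrix.cons_val_one]
    field_simp
    ring
  have r1 : rationalGamma c₁ c₂ c₃ c₄ c₅ 0 1 1 p - rationalGamma c₁ c₂ c₃ c₄ c₅ 1 0 1 p =
      -(g 0 0 p / p 0) := by
    rw [h00]
    simp only [rationalGamma, Matrix.cons_val_zero, Matrix.cons_val_one]
    field_simp
    ring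
  fin_cases i <;> fin_cases j <;> fin_cases k <;> simp only [Fin.zero_eta, Fin.mk_one]
  · linarith [key 0 0 0]
  · linarith [key 0 0 1]
  · linarith [key 0 1 0]
  · linarith [key 0 1 1]
  · linarith [key 0 1 0]
  · linarith [key 0 1 1]
  · linarith [key 1 1 0]
  · linarith [key 1 1 1]

/-- The pointwise consequences of the Jacobi identity and of compatibility force the rational form
of the metric, determine the symbols, and give the quadratic conditions. -/
theorem exists_rationalForm (hU : IsOpen U) (hUc : IsConnected U) (h0 : ∀ p ∈ U, p 0 ≠ 0)
    (hg : ∀ i j, ContDiffOn ℝ ∞ (g i j) U) (hΓ : ∀ i j k, ContDiffOn ℝ ∞ (Γ i j k) U)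
    (hH : IsHamiltonian U (hydroOperator g Γ))
    (hT : SchoutenBracketVanishes U (hydroOperator g Γ) thirdOrderOperator) :
    ∃ c₁ c₂ c₃ c₄ c₅ c₆ : ℝ, HasRationalForm U g c₁ c₂ c₃ c₄ c₅ c₆ ∧
      QuadraticConditions c₁ c₂ c₃ c₄ c₅ c₆ := by
  have hS : ∀ p ∈ U, ∀ i j k, partialDeriv k (g i j) p = Γ i j k p + Γ j i k p :=
    fun p hp i j k => (symm_of_isSkewAdjoint hU hg hΓ hH.1 hp i j k).2
  have hsymm : ∀ p ∈ U, g 1 0 p = g 0 1 p :=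
    fun p hp => (symm_of_isSkewAdjoint hU hg hΓ hH.1 hp 1 0 0).1
  -- The two antisymmetry relations, solved for `Γ^{12}_k - Γ^{21}_k`.
  have hA₀ : ∀ p ∈ U, Γ 0 1 0 p - Γ 1 0 0 p = g 0 1 p / p 0 := fun p hp => by
    have hp0 := h0 p hp
    have e1 := antisymm_relation_q hU hg hΓ hS h0 hT hp
    have e2 := antisymm_relation_s hU hg hΓ hS h0 hT hp
    rw [hsymm p hp] at e1 e2
    rw [← sub_eq_zero] at e1 e2 ⊢
    refine Eq.trans ?_ ((congrArg₂ (fun s t => (p 1 ^ 2 + 1) * s - p 0 * p 1 * t) e1 e2).trans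
      (by ring))
    field_simp
    ring
  have hA₁ : ∀ p ∈ U, Γ 0 1 1 p - Γ 1 0 1 p = -(g 0 0 p / p 0) := fun p hp => by
    have hp0 := h0 p hp
    have e1 := antisymm_relation_q hU hg hΓ hS h0 hT hp
    have e2 := antisymm_relation_s hU hg hΓ hS h0 hT hp
    rw [hsymm p hp] at e1 e2
    rw [← sub_eq_zero] at e1 e2 ⊢
    refine Eq.trans ?_ ((congrArg₂ (fun s t => p 0 ^ 2 * t - p 0 * p 1 * s) e1 e2).trans
      (by ring))
    field_simp
    ring
  have g00 : ∀ p ∈ U, ∀ k, Γ 0 0 k p = 1 / 2 * partialDeriv k (g 0 0) p := fun p hp k => by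
    rw [hS p hp]
    ring
  have g11 : ∀ p ∈ U, ∀ k, Γ 1 1 k p = 1 / 2 * partialDeriv k (g 1 1) p := fun p hp k => by
    rw [hS p hp]
    ring
  have g010 : ∀ p ∈ U, Γ 0 1 0 p = 1 / 2 * (partialDeriv 0 (g 0 1) p + g 0 1 p / p 0) :=
    fun p hp => by linarith [hS p hp 0 1 0, hA₀ p hp]
  have g011 : ∀ p ∈ U, Γ 0 1 1 p = 1 / 2 * (partialDeriv 1 (g 0 1) p - g 0 0 p / p 0) :=
    fun p hp => by linarith [hS p hp 0 1 1, hA₁ p hp]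
  -- Passes from the second derivatives of `Γ^{ii}` to those of `g^{ii}`.
  have half : ∀ {f h : (Fin 2 → ℝ) → ℝ}, (∀ p ∈ U, f p = 1 / 2 * h p) → ContDiffOn ℝ ∞ h U →
      ∀ p ∈ U, ∀ m, partialDeriv m f p = 1 / 2 * partialDeriv m h p := by
    intro f h hfh hh p hp
    have Ph := (HasPartials.const (1 / 2)).mul (HasPartials.of_contDiffOn hU hh hp)
    simp only [partialDeriv_congr hU hfh hp, Fin.forall_fin_two]
    exact ⟨Ph.partialDeriv_zero.trans (by ring), Ph.partialDeriv_one.trans (by ring)⟩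
  -- Inserting `g010` and `g011` into the closedness of `Γ^{12}_k`, the second derivatives of `g¹²`
  -- cancel.
  have hby : ∀ p ∈ U, partialDeriv 1 (g 0 1) p = g 0 0 p / p 0 - partialDeriv 0 (g 0 0) p := by
    intro p hp
    have hp0 := h0 p hp
    have Pa := HasPartials.of_contDiffOn hU (hg 0 0) hp
    have Pb := HasPartials.of_contDiffOn hU (hg 0 1) hp
    have Pb0 := HasPartials.of_contDiffOn hU (contDiffOn_partialDeriv hU (hg 0 1) 0) hp
    have Pb1 := HasPartials.of_contDiffOn hU (contDiffOn_partialDeriv hU (hg 0 1) 1) hp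
    have hN := partialDeriv_offDiag_comm hU hg hΓ hS h0 hT hp
    rw [partialDeriv_congr hU g011 hp, partialDeriv_congr hU g010 hp,
      ((HasPartials.const (1 / 2)).mul (Pb1.sub (Pa.div .fst hp0))).partialDeriv_zero,
      ((HasPartials.const (1 / 2)).mul (Pb0.add (Pb.div .fst hp0))).partialDeriv_one,
      partialDeriv_comm hU (hg 0 1) hp 0 1, ← sub_eq_zero] at hN
    rw [← sub_eq_zero]
    refine Eq.trans ?_ ((congrArg (-2 * p 0 * ·) hN).trans (mul_zero _))
    field_simp
    ring
  have hbx : ∀ p ∈ U, partialDeriv 0 (g 0 1) p = g 0 1 p / p 0 +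
      2 * (p 1 / p 0) * partialDeriv 0 (g 0 0) p +
      (p 1 ^ 2 + 1) / p 0 ^ 2 * partialDeriv 1 (g 0 0) p -
      2 * (p 1 / p 0) * (g 0 0 p / p 0) := by
    intro p hp
    have e := leading_symm hU hg hΓ hS h0 hT hp 0
    have e0 := hA₀ p hp
    have e1 := hA₁ p hp
    rw [g010 p hp] at e0
    rw [g011 p hp, hby p hp] at e1
    rw [g00 p hp, g00 p hp] at e
    linear_combination (-2) * e + 2 * e0 + 2 * (p 1 / p 0) * e1
  obtain ⟨c₁, c₂, c₃, c₄, hab⟩ := solve_first_row hU hUc h0 (hg 0 0) (hg 0 1) hby hbx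
    fun p hp m => by
      have e := hessian_relation_first hU hg hΓ hS h0 hT hp m
      rw [half (fun z hz => g00 z hz 0) (contDiffOn_partialDeriv hU (hg 0 0) 0) p hp m,
        half (fun z hz => g00 z hz 1) (contDiffOn_partialDeriv hU (hg 0 0) 1) p hp m] at e
      linear_combination 2 * e
  -- With `g¹¹` and `g¹²` known, the symbols `Γ^{12}_k` are constant.
  have da : ∀ p ∈ U, partialDeriv 0 (g 0 0) p = c₁ := fun p hp => by
    rw [partialDeriv_congr hU (fun z hz => (hab z hz).1) hp]
    exact ((((HasPartials.const c₁).mul .fst).add ((HasPartials.const c₂).mul .snd)).add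
      (.const c₃)).partialDeriv_zero.trans (by ring)
  have da1 : ∀ p ∈ U, partialDeriv 1 (g 0 0) p = c₂ := fun p hp => by
    rw [partialDeriv_congr hU (fun z hz => (hab z hz).1) hp]
    exact ((((HasPartials.const c₁).mul .fst).add ((HasPartials.const c₂).mul .snd)).add
      (.const c₃)).partialDeriv_one.trans (by ring)
  have k010 : ∀ p ∈ U, Γ 0 1 0 p = c₄ := fun p hp => by
    have hp0 := h0 p hp
    rw [g010 p hp, hbx p hp, da p hp, da1 p hp, (hab p hp).1, (hab p hp).2]
    field_simp
    ring
  have k011 : ∀ p ∈ U, Γ 0 1 1 p = -c₁ / 2 := fun p hp => by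
    rw [g011 p hp, hby p hp, da p hp]
    ring
  have hdd := fun p hp m => hessian_relation_second hU hg hΓ hS h0 hT (p := p) hp m
  have hd0 := half (fun z hz => g11 z hz 0) (contDiffOn_partialDeriv hU (hg 1 1) 0)
  have hd1 := half (fun z hz => g11 z hz 1) (contDiffOn_partialDeriv hU (hg 1 1) 1)
  obtain ⟨c₅, c₆, hd⟩ := solve_second_row (c₁ := c₁) (c₄ := c₄) hU hUc h0 (hg 1 1)
    (fun p hp => by
      have e := leading_symm hU hg hΓ hS h0 hT hp 1
      rw [k010 p hp, k011 p hp, g11 p hp, g11 p hp] at e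
      linear_combination (-2) * e)
    (fun p hp => by
      have e := hdd p hp 0
      rw [hd0 p hp, hd1 p hp] at e
      simp [qVar, sVar, k010 p hp, g11 p hp] at e
      linear_combination 2 * e)
    (fun p hp => by
      have e := hdd p hp 1
      rw [hd0 p hp, hd1 p hp] at e
      simp [qVar, sVar, k011 p hp, g11 p hp] at e
      linear_combination 2 * e)
  have hform : HasRationalForm U g c₁ c₂ c₃ c₄ c₅ c₆ := fun p hp =>
    ⟨(hab p hp).1, (hab p hp).2, hsymm p hp, hd p hp⟩
  exact ⟨c₁, c₂, c₃, c₄, c₅, c₆, hform, hform.quadraticConditions hU hUc h0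
    (fun p hp => eq_rationalGamma hU h0 hform hS hp (hA₀ p hp) (hA₁ p hp))
    fun p hp => torsion_of_isHamiltonian hU hg hΓ hS hH hp⟩

end

/-! ### The rational metrics give compatible Hamiltonian operators -/

section
variable {U : Set (Fin 2 → ℝ)} {u : TwoFun}
  {g : Fin 2 → Fin 2 → (Fin 2 → ℝ) → ℝ} {Γ : Fin 2 → Fin 2 → Fin 2 → (Fin 2 → ℝ) → ℝ}
  {c₁ c₂ c₃ c₄ c₅ c₆ : ℝ}

/-- The partial derivatives of `rationalGamma`; the last index is that of the derivative. -/
noncomputable def rationalGammaDeriv (c₁ c₂ c₃ c₅ : ℝ) (i j k l : Fin 2) (p : Fin 2 → ℝ) : ℝ :=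
  (![![![![0, 0], ![0, 0]], ![![0, 0], ![0, 0]]],
    ![![![(c₂ * (p 1 ^ 2 - 1) + 2 * c₃ * p 1) / p 0 ^ 3, -(c₂ * p 1 + c₃) / p 0 ^ 2],
        ![-(c₂ * p 1 + c₃) / p 0 ^ 2, c₂ / p 0]],
      ![![-(c₁ * (p 1 ^ 2 - 1) - c₅ * p 1) / p 0 ^ 3, -(c₅ / 2 - c₁ * p 1) / p 0 ^ 2],
        ![-(c₅ / 2 - c₁ * p 1) / p 0 ^ 2, -c₁ / p 0]]]] :
    Fin 2 → Fin 2 → Fin 2 → Fin 2 → ℝ) i j k l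

theorem hasPartials_rationalGamma {p : Fin 2 → ℝ} (hp0 : p 0 ≠ 0) (i j k : Fin 2) :
    HasPartials (rationalGamma c₁ c₂ c₃ c₄ c₅ i j k) p
      (rationalGammaDeriv c₁ c₂ c₃ c₅ i j k 0 p) (rationalGammaDeriv c₁ c₂ c₃ c₅ i j k 1 p) := by
  have hp2 : p 0 ^ 2 ≠ 0 := pow_ne_zero 2 hp0
  have hB : HasPartials (fun z => -(c₂ * (z 1 ^ 2 - 1) / 2 + c₃ * z 1) / z 0 ^ 2) p _ _ :=
    (HasPartials.neg ((((HasPartials.const c₂).mul (HasPartials.snd.pow_two.sub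
      (.const 1))).div (.const 2) two_ne_zero).add ((HasPartials.const c₃).mul .snd))).div
      HasPartials.fst.pow_two hp2
  have hC : HasPartials (fun z => c₁ / 2 + (c₂ * z 1 + c₃) / z 0) p _ _ :=
    (HasPartials.const (c₁ / 2)).add ((((HasPartials.const c₂).mul .snd).add (.const c₃)).div
      .fst hp0)
  have hD : HasPartials (fun z => (c₁ * (z 1 ^ 2 - 1) - c₅ * z 1) / (2 * z 0 ^ 2)) p _ _ :=
    (((HasPartials.const c₁).mul (HasPartials.snd.pow_two.sub (.const 1))).sub
      ((HasPartials.const c₅).mul .snd)).div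
      ((HasPartials.const 2).mul HasPartials.fst.pow_two) (by simpa using hp0)
  have hE : HasPartials (fun z => c₄ + (c₅ / 2 - c₁ * z 1) / z 0) p _ _ :=
    (HasPartials.const c₄).add (((HasPartials.const (c₅ / 2)).sub
      ((HasPartials.const c₁).mul .snd)).div .fst hp0)
  revert i j k
  simp only [Fin.forall_fin_two]
  refine ⟨⟨⟨.const _, .const _⟩, .const _, .const _⟩, ⟨hB.congr ?_ ?_, hC.congr ?_ ?_⟩,
    hD.congr ?_ ?_, hE.congr ?_ ?_⟩ <;> simp [rationalGammaDeriv] <;> field_simp <;> ring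

theorem partialDeriv_eq_rationalGammaDeriv (hU : IsOpen U) (h0 : ∀ p ∈ U, p 0 ≠ 0)
    (hΓ : ∀ p ∈ U, ∀ i j k, Γ i j k p = rationalGamma c₁ c₂ c₃ c₄ c₅ i j k p) {p : Fin 2 → ℝ}
    (hp : p ∈ U) (i j k l : Fin 2) :
    partialDeriv l (Γ i j k) p = rationalGammaDeriv c₁ c₂ c₃ c₅ i j k l p := by
  have h := hasPartials_rationalGamma (c₁ := c₁) (c₂ := c₂) (c₃ := c₃) (c₄ := c₄) (c₅ := c₅)
    (h0 p hp) i j k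
  rw [partialDeriv_congr hU (fun z hz => hΓ z hz i j k) hp]
  fin_cases l
  exacts [h.partialDeriv_zero, h.partialDeriv_one]

theorem contDiffOn_rationalGamma (h0 : ∀ p ∈ U, p 0 ≠ 0) (i j k : Fin 2) :
    ContDiffOn ℝ ∞ (rationalGamma c₁ c₂ c₃ c₄ c₅ i j k) U := by
  have e0 : ContDiffOn ℝ ∞ (fun p : Fin 2 → ℝ => p 0) U := (contDiff_apply ℝ ℝ 0).contDiffOn
  have e1 : ContDiffOn ℝ ∞ (fun p : Fin 2 → ℝ => p 1) U := (contDiff_apply ℝ ℝ 1).contDiffOn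
  have n0 : ∀ p ∈ U, p 0 ^ 2 ≠ 0 := fun p hp => pow_ne_zero 2 (h0 p hp)
  have n1 : ∀ p ∈ U, 2 * p 0 ^ 2 ≠ 0 := fun p hp => mul_ne_zero two_ne_zero (n0 p hp)
  revert i j k
  simp only [Fin.forall_fin_two]
  exact ⟨⟨⟨contDiffOn_const, contDiffOn_const⟩, contDiffOn_const, contDiffOn_const⟩,
    ⟨((((contDiffOn_const.mul ((e1.pow 2).sub contDiffOn_const)).div_const 2).add
        (contDiffOn_const.mul e1)).neg).div (e0.pow 2) n0,
      contDiffOn_const.add (((contDiffOn_const.mul e1).add contDiffOn_const).div e0 h0)⟩,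
    ((contDiffOn_const.mul ((e1.pow 2).sub contDiffOn_const)).sub (contDiffOn_const.mul e1)).div
      (contDiffOn_const.mul (e0.pow 2)) n1,
    contDiffOn_const.add ((contDiffOn_const.sub (contDiffOn_const.mul e1)).div e0 h0)⟩

/-- The covector `e_l(a, b)` to which the density of the variation of a first-order operator
reduces when the metric and the symbols are compatible and `∂_l Γ^{ij}_k = ∂_k Γ^{ij}_l`. -/
noncomputable def hydroCovector (Γ : Fin 2 → Fin 2 → Fin 2 → (Fin 2 → ℝ) → ℝ) (u a b : TwoFun)
    (l : Fin 2) : ℝ → ℝ := fun x =>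
  ∑ i, ∑ j, (Γ j i l (u x) * (a x i * xDeriv b x j) - Γ i j l (u x) * (xDeriv a x i * b x j))

theorem hydroDensity_eq_sum_hydroCovector (hu : ∀ x, u x ∈ U)
    (hS : ∀ p ∈ U, ∀ i j k, partialDeriv k (g i j) p = Γ i j k p + Γ j i k p)
    (hC : ∀ p ∈ U, ∀ i j k l, partialDeriv l (Γ i j k) p = partialDeriv k (Γ i j l) p)
    (a b v : TwoFun) (x : ℝ) :
    hydroDensity g Γ u a b v x = ∑ l, hydroCovector Γ u a b l x * v x l := by
  simp only [hydroDensity, hydroCovector, hS _ (hu x), Fin.sum_univ_two,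
    hC _ (hu x) _ _ 0 1]
  ring

/-- The Jacobi identity holds pointwise when the symbols are symmetric with respect to `g` and
the connection is flat in the sense that `Γ^{j1}_l Γ^{l2}_m = Γ^{j2}_l Γ^{l1}_m`. -/
theorem jacobiDensity_eq_zero (hu : ∀ x, u x ∈ U) (hsymm : ∀ p ∈ U, g 1 0 p = g 0 1 p)
    (hS : ∀ p ∈ U, ∀ i j k, partialDeriv k (g i j) p = Γ i j k p + Γ j i k p)
    (hC : ∀ p ∈ U, ∀ i j k l, partialDeriv l (Γ i j k) p = partialDeriv k (Γ i j l) p)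
    (hH : ∀ p ∈ U, ∀ i, Γ 0 i 0 p * g 0 1 p + Γ 0 i 1 p * g 1 1 p =
      Γ 1 i 0 p * g 0 0 p + Γ 1 i 1 p * g 1 0 p)
    (hZ : ∀ p ∈ U, ∀ j m, Γ j 0 0 p * Γ 0 1 m p + Γ j 0 1 p * Γ 1 1 m p =
      Γ j 1 0 p * Γ 0 0 m p + Γ j 1 1 p * Γ 1 0 m p) (a b c : TwoFun) (x : ℝ) :
    jacobiDensity g Γ u a b c x = 0 := by
  have H := hH _ (hu x)
  have Z := hZ _ (hu x)
  -- The bracket density is a sum of a part without and a part with `u_x`, which vanish separately.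
  let w := fun a b : TwoFun => xDeriv a x 0 * xDeriv b x 1 - xDeriv a x 1 * xDeriv b x 0
  let m := fun i => xDeriv a x i * (b x 0 * c x 1 - b x 1 * c x 0) +
    xDeriv b x i * (c x 0 * a x 1 - c x 1 * a x 0) + xDeriv c x i * (a x 0 * b x 1 - a x 1 * b x 0)
  simp only [jacobiDensity, hydroDensity_eq_sum_hydroCovector hu hS hC, hydroCovector,
    hydroOperator_apply, Fin.sum_univ_two]
  rw [hsymm _ (hu x)] at H ⊢
  linear_combination
    H 0 * (a x 0 * w b c + b x 0 * w c a + c x 0 * w a b) +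
    H 1 * (a x 1 * w b c + b x 1 * w c a + c x 1 * w a b) -
    Z 0 0 * (xDeriv u x 0 * m 0) - Z 0 1 * (xDeriv u x 1 * m 0) -
    Z 1 0 * (xDeriv u x 0 * m 1) - Z 1 1 * (xDeriv u x 1 * m 1)
end

section
variable {U : Set (Fin 2 → ℝ)} {u : TwoFun}
  {g : Fin 2 → Fin 2 → (Fin 2 → ℝ) → ℝ} {Γ : Fin 2 → Fin 2 → Fin 2 → (Fin 2 → ℝ) → ℝ}
  {c₁ c₂ c₃ c₄ c₅ c₆ : ℝ}

/-- The flux `thirdFlux` with all derivatives carried out. -/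
theorem thirdFlux_apply (hu : ContDiff ℝ ∞ u) (h0 : ∀ x, u x 0 ≠ 0) {c : TwoFun}
    (hc : ContDiff ℝ ∞ c) (x : ℝ) :
    thirdFlux (qField u) (sField u) c x =
      ![xDeriv (xDeriv c) x 0 + (qVar u (xDeriv u) x * xDeriv c x 1 +
          qField u x * xDeriv (xDeriv c) x 1),
        qField u x * xDeriv (xDeriv c) x 0 + (sField u x * xDeriv (xDeriv c) x 1 +
          (sVar u (xDeriv u) x * xDeriv c x 1 + sField u x * xDeriv (xDeriv c) x 1))] := by
  have dq := contDiff_hasDerivAt (contDiff_qField hu h0) x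
  have ds := contDiff_hasDerivAt (contDiff_sField hu h0) x
  have c1 := hasDerivAt_component (contDiff_xDeriv hc) 1 x
  rw [deriv_qField hu h0] at dq
  rw [deriv_sField hu h0] at ds
  rw [thirdFlux, show deriv (fun z => qField u z * xDeriv c z 1) x = _ from (dq.mul c1).deriv,
    show deriv (fun z => sField u z * xDeriv c z 1) x = _ from (ds.mul c1).deriv]

/-- The primitive of the density of the Schouten bracket for the rational metrics. -/
noncomputable def schoutenPrimitive (Γ : Fin 2 → Fin 2 → Fin 2 → (Fin 2 → ℝ) → ℝ)
    (u a b c : TwoFun) : ℝ → ℝ := fun x =>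
  ∑ l, (hydroCovector Γ u a b l x * thirdFlux (qField u) (sField u) c x l +
    hydroCovector Γ u b c l x * thirdFlux (qField u) (sField u) a x l +
    hydroCovector Γ u c a l x * thirdFlux (qField u) (sField u) b x l)

theorem hasDerivAt_hydroCovector (hU : IsOpen U) (hΓ : ∀ i j k, ContDiffOn ℝ ∞ (Γ i j k) U)
    (hu : IsSmoothField U u) {a b : TwoFun} (ha : ContDiff ℝ ∞ a) (hb : ContDiff ℝ ∞ b)
    (l : Fin 2) (x : ℝ) :
    HasDerivAt (hydroCovector Γ u a b l)
      (∑ i, ∑ j, ((∑ k, partialDeriv k (Γ j i l) (u x) * xDeriv u x k) * (a x i * xDeriv b x j) +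
        Γ j i l (u x) * (xDeriv a x i * xDeriv b x j + a x i * xDeriv (xDeriv b) x j) -
        ((∑ k, partialDeriv k (Γ i j l) (u x) * xDeriv u x k) * (xDeriv a x i * b x j) +
        Γ i j l (u x) * (xDeriv (xDeriv a) x i * b x j + xDeriv a x i * xDeriv b x j)))) x := by
  have dΓ := fun i j => hasDerivAt_comp_field hU (hΓ i j l) hu x
  have da := fun i => hasDerivAt_component ha i x
  have db := fun i => hasDerivAt_component hb i x
  have da' := fun i => hasDerivAt_component (contDiff_xDeriv ha) i x
  have db' := fun i => hasDerivAt_component (contDiff_xDeriv hb) i x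
  exact HasDerivAt.fun_sum fun i _ => HasDerivAt.fun_sum fun j _ =>
    ((dΓ j i).mul ((da i).mul (db' j))).sub ((dΓ i j).mul ((da' i).mul (db j)))

theorem HasRationalForm.partialDeriv_eq_add (hU : IsOpen U) (h0 : ∀ p ∈ U, p 0 ≠ 0)
    (h : HasRationalForm U g c₁ c₂ c₃ c₄ c₅ c₆)
    (hΓr : ∀ p ∈ U, ∀ i j k, Γ i j k p = rationalGamma c₁ c₂ c₃ c₄ c₅ i j k p) :
    ∀ p ∈ U, ∀ i j k, partialDeriv k (g i j) p = Γ i j k p + Γ j i k p := by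
  intro p hp i j k
  rw [hΓr p hp, hΓr p hp, h.partialDeriv_eq hU h0 hp]

/-- For fixed `i`, `j` the one-form with components `Γ^{ij}_k` is closed. -/
theorem partialDeriv_symbol_comm (hU : IsOpen U) (h0 : ∀ p ∈ U, p 0 ≠ 0)
    (hΓr : ∀ p ∈ U, ∀ i j k, Γ i j k p = rationalGamma c₁ c₂ c₃ c₄ c₅ i j k p) :
    ∀ p ∈ U, ∀ i j k l, partialDeriv l (Γ i j k) p = partialDeriv k (Γ i j l) p := by
  intro p hp
  simp only [partialDeriv_eq_rationalGammaDeriv hU h0 hΓr hp, Fin.forall_fin_two]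
  simp [rationalGammaDeriv]

theorem HasRationalForm.torsion_eq (h0 : ∀ p ∈ U, p 0 ≠ 0)
    (h : HasRationalForm U g c₁ c₂ c₃ c₄ c₅ c₆) (hQ : QuadraticConditions c₁ c₂ c₃ c₄ c₅ c₆)
    (hΓr : ∀ p ∈ U, ∀ i j k, Γ i j k p = rationalGamma c₁ c₂ c₃ c₄ c₅ i j k p) :
    ∀ p ∈ U, ∀ i, Γ 0 i 0 p * g 0 1 p + Γ 0 i 1 p * g 1 1 p =
      Γ 1 i 0 p * g 0 0 p + Γ 1 i 1 p * g 1 0 p := by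
  intro p hp
  obtain ⟨q1, q2, q3⟩ := hQ
  have t0 := h.torsion_zero h0 hp
  have t1 := h.torsion_one h0 hp
  rw [q1, q2] at t0
  rw [q1, q3] at t1
  simp only [zero_mul, add_zero, zero_div, sub_zero] at t0 t1
  simp only [hΓr p hp, Fin.forall_fin_two]
  exact ⟨sub_eq_zero.1 ((mul_eq_zero.1 t0).resolve_left (by simpa using h0 p hp)),
    sub_eq_zero.1 ((mul_eq_zero.1 t1).resolve_left (by simpa using h0 p hp))⟩

/-- For a rational metric with its symbols the density of the Schouten bracket is a total
derivative: moving the derivative of the flux of the third-order operator onto `hydroCovector`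
cancels the remaining terms. The quadratic conditions are not needed for this. -/
theorem hasDerivAt_schoutenPrimitive (hU : IsOpen U) (h0 : ∀ p ∈ U, p 0 ≠ 0)
    (hΓ : ∀ i j k, ContDiffOn ℝ ∞ (Γ i j k) U) (h : HasRationalForm U g c₁ c₂ c₃ c₄ c₅ c₆)
    (hΓr : ∀ p ∈ U, ∀ i j k, Γ i j k p = rationalGamma c₁ c₂ c₃ c₄ c₅ i j k p)
    (hu : IsSmoothField U u) {a b c : TwoFun} (ha : ContDiff ℝ ∞ a) (hb : ContDiff ℝ ∞ b)
    (hc : ContDiff ℝ ∞ c) (x : ℝ) :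
    HasDerivAt (schoutenPrimitive Γ u a b c) (schoutenDensity g Γ u a b c x) x := by
  have hu0 : ∀ y, u y 0 ≠ 0 := fun y => h0 _ (hu.2 y)
  have hG := fun {p} hp => partialDeriv_eq_rationalGammaDeriv (p := p) hU h0 hΓr hp
  have hS := h.partialDeriv_eq_add hU h0 hΓr
  have hC := partialDeriv_symbol_comm hU h0 hΓr
  have dW := fun {c : TwoFun} (hc : ContDiff ℝ ∞ c) l => hasDerivAt_component
    (contDiff_thirdFlux (contDiff_qField hu.1 hu0) (contDiff_sField hu.1 hu0) hc) l x
  simp only [← thirdOrderOperator_eq_xDeriv] at dW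
  have de := fun {a b : TwoFun} (ha : ContDiff ℝ ∞ a) (hb : ContDiff ℝ ∞ b) l =>
    hasDerivAt_hydroCovector hU hΓ hu ha hb l x
  refine (HasDerivAt.fun_sum fun l _ => (((de ha hb l).mul (dW hc l)).add
    ((de hb hc l).mul (dW ha l))).add ((de hc ha l).mul (dW hb l))).congr_deriv ?_
  simp only [schoutenDensity, hydroDensity_eq_sum_hydroCovector hu.2 hS hC,
    thirdFlux_apply hu.1 hu0 ha, thirdFlux_apply hu.1 hu0 hb, thirdFlux_apply hu.1 hu0 hc]
  have hx := hu0 x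
  obtain ⟨g00, g01, g10, g11⟩ := h (u x) (hu.2 x)
  -- The combinations of the metric through which the third-order terms enter.
  have Xq : -(u x 1 / u x 0 ^ 2) * g 0 0 (u x) + 1 / u x 0 * g 1 0 (u x) =
      c₄ - c₁ * u x 1 / u x 0 - u x 1 * (c₂ * u x 1 + c₃) / u x 0 ^ 2 +
        (c₂ * (u x 1 ^ 2 - 1) / 2 + c₃ * u x 1) / u x 0 ^ 2 := by
    rw [g10, g00, g01]
    field_simp
    ring
  have Xs : -((u x 1 ^ 2 + 1) / u x 0 ^ 3) * g 0 0 (u x) + u x 1 / u x 0 ^ 2 * g 1 0 (u x) =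
      c₄ * u x 1 / u x 0 - c₁ * (u x 1 ^ 2 + 1) / u x 0 ^ 2 -
        (u x 1 ^ 2 + 1) * (c₂ * u x 1 + c₃) / u x 0 ^ 3 +
        u x 1 * (c₂ * (u x 1 ^ 2 - 1) / 2 + c₃ * u x 1) / u x 0 ^ 3 := by
    rw [g10, g00, g01]
    field_simp
    ring
  let A := fun a b : TwoFun =>
    xDeriv (xDeriv a) x 0 * xDeriv b x 1 - xDeriv (xDeriv b) x 0 * xDeriv a x 1
  let B := fun a b : TwoFun =>
    xDeriv (xDeriv a) x 1 * xDeriv b x 1 - xDeriv a x 1 * xDeriv (xDeriv b) x 1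
  simp only [thirdDensity, hydroOperator_apply, Fin.sum_univ_two, hG (hu.2 x), hΓr _ (hu.2 x),
    rationalGamma, rationalGammaDeriv, qVar, sVar, qField, sField,
    Matrix.cons_val_zero, Matrix.cons_val_one]
  linear_combination
    -Xq * (xDeriv c x 0 * A a b + xDeriv a x 0 * A b c + xDeriv b x 0 * A c a) -
    Xs * (xDeriv c x 0 * B a b + xDeriv a x 0 * B b c + xDeriv b x 0 * B c a)

/-- Rational metrics with the quadratic conditions, degenerate ones included, give Hamiltonian
operators compatible with the third-order one. The conditions are needed for the Jacobi identity
only, where they give both the torsion relation and flatness. -/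
theorem HasRationalForm.isHamiltonian_and_schoutenBracketVanishes (hU : IsOpen U)
    (h0 : ∀ p ∈ U, p 0 ≠ 0) (hg : ∀ i j, ContDiffOn ℝ ∞ (g i j) U)
    (hΓ : ∀ i j k, ContDiffOn ℝ ∞ (Γ i j k) U) (h : HasRationalForm U g c₁ c₂ c₃ c₄ c₅ c₆)
    (hQ : QuadraticConditions c₁ c₂ c₃ c₄ c₅ c₆)
    (hΓr : ∀ p ∈ U, ∀ i j k, Γ i j k p = rationalGamma c₁ c₂ c₃ c₄ c₅ i j k p) :
    IsHamiltonian U (hydroOperator g Γ) ∧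
      SchoutenBracketVanishes U (hydroOperator g Γ) thirdOrderOperator := by
  have hS := h.partialDeriv_eq_add hU h0 hΓr
  have hC := partialDeriv_symbol_comm hU h0 hΓr
  have hZ : ∀ p ∈ U, ∀ j m, Γ j 0 0 p * Γ 0 1 m p + Γ j 0 1 p * Γ 1 1 m p =
      Γ j 1 0 p * Γ 0 0 m p + Γ j 1 1 p * Γ 1 0 m p := by
    intro p hp
    have hp0 := h0 p hp
    obtain ⟨q1, q2, q3⟩ := hQ
    simp only [Fin.forall_fin_two, hΓr p hp, rationalGamma, Matrix.cons_val_zero,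
      Matrix.cons_val_one]
    refine ⟨⟨?_, ?_⟩, ?_, ?_⟩
    · linear_combination (-p 1 / (4 * p 0 ^ 2)) * q1
    · linear_combination (1 / (4 * p 0)) * q1
    · linear_combination (-(p 1 ^ 2 + 1) / (4 * p 0 ^ 3)) * q1
    · linear_combination (p 1 / (4 * p 0 ^ 2)) * q1
  refine ⟨⟨fun u hu a b ha hb => ?_, fun u hu a b c ha hb hc => ?_⟩,
    fun u hu a b c ha hb hc => ?_⟩
  · have e := pairing_add_pairing_hydroOperator hU hg hΓ hu ha hb
    have hd : skewDefect g Γ u b = 0 := by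
      funext x i
      simp [skewDefect, h.symm (hu.2 x) i, hS _ (hu.2 x), add_comm]
    rw [hd] at e
    simp only [pairing, Pi.zero_apply, mul_zero, Finset.sum_const_zero, integral_zero] at e
    exact eq_neg_of_add_eq_zero_left e
  · rw [jacobiator_hydroOperator hU hg hΓ hu ha hb hc]
    simp [jacobiDensity_eq_zero hu.2 (fun p hp => (h p hp).2.2.1) hS hC
      (h.torsion_eq h0 hQ hΓr) hZ]
  · rw [jacobiator_add_jacobiator hU hg hΓ hu h0 ha hb hc]
    have hd := hasDerivAt_schoutenPrimitive hU h0 hΓ h hΓr hu ha.1 hb.1 hc.1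
    have P := fun c (hc : IsTest c) => contDiff_hydroOperator hU hg hΓ hu hc.1
    have R := fun c (hc : IsTest c) =>
      contDiff_thirdOrderOperator hu.1 (fun x => h0 _ (hu.2 x)) hc.1
    have cP := fun {a b c} (ha : IsTest a) (hb : IsTest b) (hc : IsTest c) =>
      contDiff_hydroDensity hU hg hΓ hu ha.1 hb.1 (R c hc)
    have cR := fun {a b c} (ha : IsTest a) (hb : IsTest b) (hc : IsTest c) =>
      contDiff_thirdDensity hu.1 (fun x => h0 _ (hu.2 x)) ha.1 hb.1 (P c hc)
    have hcont : ContDiff ℝ ∞ (schoutenDensity g Γ u a b c) :=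
      (((cP ha hb hc).add (cP hb hc ha)).add (cP hc ha hb)).add
        (((cR ha hb hc).add (cR hb hc ha)).add (cR hc ha hb))
    have hsupp : ∀ x, x ∉ tsupport a ∪ tsupport b ∪ tsupport c →
        x ∉ tsupport a ∧ x ∉ tsupport b ∧ x ∉ tsupport c := fun x hx => by
      simpa [and_assoc] using hx
    refine (integral_eq_of_hasDerivAt_sub (g := fun _ => 0)
      (fun x => (hd x).congr_deriv (sub_zero _).symm) hcont.continuous continuous_const
      ((ha.2.union hb.2).union hc.2) ?_ ?_ fun _ _ => rfl).trans (integral_zero _ _) <;>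
    · intro x hx
      obtain ⟨ka, kb, kc⟩ := hsupp x hx
      simp [schoutenPrimitive, schoutenDensity, hydroCovector, eq_zero_of_notMem_tsupport ka,
        eq_zero_of_notMem_tsupport kb, eq_zero_of_notMem_tsupport kc, xDeriv_eq_zero_of_notMem ka,
        xDeriv_eq_zero_of_notMem kb, xDeriv_eq_zero_of_notMem kc, hydroDensity_eq_zero_of_notMem,
        thirdDensity_eq_zero_of_notMem, ka, kb, kc]

end

/-! ### Levi-Civita symbols and the classification -/

section
variable {U : Set (Fin 2 → ℝ)}
  {g : Fin 2 → Fin 2 → (Fin 2 → ℝ) → ℝ} {Γ : Fin 2 → Fin 2 → Fin 2 → (Fin 2 → ℝ) → ℝ}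
  {c₁ c₂ c₃ c₄ c₅ c₆ : ℝ}

/-- Hamiltonian first-order operators have Levi-Civita symbols, also when the metric degenerates. -/
theorem IsHamiltonian.isLeviCivita (hU : IsOpen U) (hg : ∀ i j, ContDiffOn ℝ ∞ (g i j) U)
    (hΓ : ∀ i j k, ContDiffOn ℝ ∞ (Γ i j k) U) (hH : IsHamiltonian U (hydroOperator g Γ)) :
    IsLeviCivita U g Γ := by
  have hS : ∀ p ∈ U, ∀ i j k, partialDeriv k (g i j) p = Γ i j k p + Γ j i k p :=
    fun p hp i j k => (symm_of_isSkewAdjoint hU hg hΓ hH.1 hp i j k).2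
  intro p hp
  have hsymm : g 1 0 p = g 0 1 p := (symm_of_isSkewAdjoint hU hg hΓ hH.1 hp 1 0 0).1
  have T := torsion_of_isHamiltonian hU hg hΓ hS hH hp
  rw [hsymm] at T
  refine ⟨?_, fun i j k => (hS p hp i j k).symm⟩
  simp only [Fin.forall_fin_two, Fin.sum_univ_two, hsymm]
  exact ⟨⟨⟨trivial, trivial⟩, by linear_combination -T 0, by linear_combination -T 1⟩,
    ⟨by linear_combination T 0, by linear_combination T 1⟩,
    trivial, trivial⟩

/-- For a nondegenerate rational metric the Levi-Civita symbols are the rational ones: both solve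
the same linear system, whose determinant is that of the metric. -/
theorem IsLeviCivita.eq_rationalGamma (hU : IsOpen U) (h0 : ∀ p ∈ U, p 0 ≠ 0)
    (hdet : ∀ p ∈ U, (Matrix.of fun i j => g i j p).det ≠ 0) (hL : IsLeviCivita U g Γ)
    (h : HasRationalForm U g c₁ c₂ c₃ c₄ c₅ c₆) (hQ : QuadraticConditions c₁ c₂ c₃ c₄ c₅ c₆)
    {p : Fin 2 → ℝ} (hp : p ∈ U) (i j k : Fin 2) :
    Γ i j k p = rationalGamma c₁ c₂ c₃ c₄ c₅ i j k p := by
  have key := fun i j k => ((hL p hp).2 i j k).trans (h.partialDeriv_eq hU h0 hp i j k)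
  have T := h.torsion_eq (Γ := rationalGamma c₁ c₂ c₃ c₄ c₅) h0 hQ (fun _ _ _ _ _ => rfl) p hp
  have L := (hL p hp).1
  have hd := hdet p hp
  have hs := (h p hp).2.2.1
  simp only [Fin.sum_univ_two] at L
  simp only [Matrix.det_fin_two, Matrix.of_apply] at hd
  rw [hs] at T hd
  have L0 := L 0 1 0
  have L1 := L 0 1 1
  rw [hs] at L0 L1
  have e00 : ∀ k, Γ 0 0 k p = rationalGamma c₁ c₂ c₃ c₄ c₅ 0 0 k p := fun k => by
    linarith [key 0 0 k]
  have e11 : ∀ k, Γ 1 1 k p = rationalGamma c₁ c₂ c₃ c₄ c₅ 1 1 k p := fun k => by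
    linarith [key 1 1 k]
  have e01 : ∀ k, Γ 0 1 k p = rationalGamma c₁ c₂ c₃ c₄ c₅ 0 1 k p -
      (Γ 1 0 k p - rationalGamma c₁ c₂ c₃ c₄ c₅ 1 0 k p) := fun k => by
    linarith [key 0 1 k]
  have T0 := T 0
  have T1 := T 1
  rw [e00, e00] at L0
  rw [e11, e11, e01, e01] at L1
  -- The differences of the two solutions for `Γ²¹_k` are annihilated by `g`.
  have hδ : ∀ {δ : ℝ}, (g 0 0 p * g 1 1 p - g 0 1 p * g 0 1 p) * δ = 0 → δ = 0 := fun e =>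
    (mul_eq_zero.1 e).resolve_left hd
  have d0 : Γ 1 0 0 p = rationalGamma c₁ c₂ c₃ c₄ c₅ 1 0 0 p := sub_eq_zero.1 <| hδ <| by
    linear_combination g 1 1 p * (L0 + T0) - g 0 1 p * (L1 + T1)
  have d1 : Γ 1 0 1 p = rationalGamma c₁ c₂ c₃ c₄ c₅ 1 0 1 p := sub_eq_zero.1 <| hδ <| by
    linear_combination g 0 0 p * (L1 + T1) - g 0 1 p * (L0 + T0)
  have f0 : Γ 0 1 0 p = rationalGamma c₁ c₂ c₃ c₄ c₅ 0 1 0 p := by rw [e01, d0]; ring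
  have f1 : Γ 0 1 1 p = rationalGamma c₁ c₂ c₃ c₄ c₅ 0 1 1 p := by rw [e01, d1]; ring
  revert i j k
  simp only [Fin.forall_fin_two]
  exact ⟨⟨⟨e00 0, e00 1⟩, f0, f1⟩, ⟨d0, d1⟩, e11 0, e11 1⟩

end

theorem theorem4 (U : Set (Fin 2 → ℝ)) (hUo : IsOpen U) (hUc : IsConnected U)
    (hU0 : ∀ p ∈ U, p 0 ≠ 0)
    (g : Fin 2 → Fin 2 → (Fin 2 → ℝ) → ℝ)
    (hg : ∀ i j, ContDiffOn ℝ ∞ (g i j) U) :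
    ((∃ Γ : Fin 2 → Fin 2 → Fin 2 → (Fin 2 → ℝ) → ℝ,
        (∀ i j k, ContDiffOn ℝ ∞ (Γ i j k) U) ∧
        IsHamiltonian U (hydroOperator g Γ) ∧
        SchoutenBracketVanishes U (hydroOperator g Γ) thirdOrderOperator) ↔
      ∃ c₁ c₂ c₃ c₄ c₅ c₆ : ℝ,
        HasRationalForm U g c₁ c₂ c₃ c₄ c₅ c₆ ∧ QuadraticConditions c₁ c₂ c₃ c₄ c₅ c₆) ∧
    ((∀ p ∈ U, (Matrix.of fun i j => g i j p).det ≠ 0) →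
      ∀ Γ : Fin 2 → Fin 2 → Fin 2 → (Fin 2 → ℝ) → ℝ,
        (∀ i j k, ContDiffOn ℝ ∞ (Γ i j k) U) →
        ((IsHamiltonian U (hydroOperator g Γ) ∧
            SchoutenBracketVanishes U (hydroOperator g Γ) thirdOrderOperator) ↔
          IsLeviCivita U g Γ ∧
          ∃ c₁ c₂ c₃ c₄ c₅ c₆ : ℝ,
            HasRationalForm U g c₁ c₂ c₃ c₄ c₅ c₆ ∧
            QuadraticConditions c₁ c₂ c₃ c₄ c₅ c₆)) := by
  refine ⟨⟨?_, ?_⟩, fun hdet Γ hΓ => ⟨?_, ?_⟩⟩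
  · rintro ⟨Γ, hΓ, hH, hT⟩
    exact exists_rationalForm hUo hUc hU0 hg hΓ hH hT
  · rintro ⟨c₁, c₂, c₃, c₄, c₅, c₆, hr, hQ⟩
    have hΓ := contDiffOn_rationalGamma (c₁ := c₁) (c₂ := c₂) (c₃ := c₃) (c₄ := c₄) (c₅ := c₅) hU0
    exact ⟨_, hΓ, hr.isHamiltonian_and_schoutenBracketVanishes hUo hU0 hg hΓ hQ
      fun _ _ _ _ _ => rfl⟩
  · rintro ⟨hH, hT⟩
    exact ⟨hH.isLeviCivita hUo hg hΓ, exists_rationalForm hUo hUc hU0 hg hΓ hH hT⟩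
  · rintro ⟨hL, c₁, c₂, c₃, c₄, c₅, c₆, hr, hQ⟩
    exact hr.isHamiltonian_and_schoutenBracketVanishes hUo hU0 hg hΓ hQ
      fun _ hp => hL.eq_rationalGamma hUo hU0 hdet hr hQ hp
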